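/- Let $T$ be a triangulation (a simplicial complex) of a surface with or without boundary, let $i$ be an interior vertex of $T$, and let $R_i$ be its $1$-ring neighborhood, i.e. the subcomplex consisting of all triangles containing $i$ together with their edges and vertices. Write $V(R_i)$ for its set of vertices and $\partial R_i$ for the set of vertices on its boundary. Let $\mathbb{D}$ be the Poincaré disc with hyperbolic distance $d^h$ of curvature $-1$, so that $\sinh\frac{d^h(z,w)}{2}=\frac{|z-w|}{\sqrt{(1-|z|^2)(1-|w|^2)}}$. A hyperbolic geodesic embedding $\phi^h:R_i\to\mathbb{D}$ is a homeomorphism of the underlying space of $R_i$ onto its image which maps every edge $jk$ to the hyperbolic geodesic segment connecting $\phi^h(j)$ and $\phi^h(k)$; it induces the lengths $l^h_{jk}=d^h(\phi^h(j),\phi^h(k))$ on the edges. It is called Delaunay if for every two adjacent triangles $abc$, $abd$ of $R_i$ sharing the edge $ab$, the point $\phi^h(d)$ does not lie in the interior of the Euclidean circle through $\phi^h(a),\phi^h(b),\phi^h(c)$ (no condition is imposed by $abc$ if these three points lie on a Euclidean line). Let $\phi^h,\phi^{h\prime}:R_i\to\mathbb{D}$ be two Delaunay hyperbolic geodesic embeddings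 with induced lengths $l^h,l^{h\prime}$. Suppose that they are hyperbolic discrete conformal with hyperbolic conformal factor $u^h:V(R_i)\to\mathbb{R}$, that is, $$\sinh\frac{l^{h\prime}_{jk}}{2}=e^{(u^h_j+u^h_k)/2}\,\sinh\frac{l^h_{jk}}{2}\qquad\text{for every edge } jk \text{ of } R_i.$$ Then $$\min\bigl(\{u^h_j : j\in V(R_i)\}\cup\{0\}\bigr)\ \ge\ \min\bigl(\{u^h_j : j\in\partial R_i\}\cup\{0\}\bigr).$$ Furthermore, if $u^h_i=\min\bigl(\{u^h_j : j\in V(R_i)\}\cup\{0\}\bigr)$, then $u^h_j=0$ for every $j\in V(R_i)$. -/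

import Mathlib

/-- Hyperbolic distance of the Poincaré disc model (curvature `-1`). -/
noncomputable def hypDist (z w : Complex.UnitDisc) : ℝ :=
  2 * Real.arsinh (‖(z : ℂ) - (w : ℂ)‖ /
    Real.sqrt ((1 - ‖(z : ℂ)‖ ^ 2) * (1 - ‖(w : ℂ)‖ ^ 2)))

/-- The hyperbolic geodesic segment with end points `z` and `w`: the points of the disc lying
metrically between `z` and `w`. -/
def hypSegment (z w : Complex.UnitDisc) : Set Complex.UnitDisc :=
  {x | hypDist z x + hypDist x w = hypDist z w}

section Combinatorics

variable {V : Type*} [DecidableEq V]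

/-- The vertices of an abstract simplicial complex. -/
def vertexSet (K : PreAbstractSimplicialComplex V) : Set V :=
  {v | ({v} : Finset V) ∈ K}

/-- `a` and `b` are the two distinct end points of an edge of `K`. -/
def IsEdge (K : PreAbstractSimplicialComplex V) (a b : V) : Prop :=
  a ≠ b ∧ ({a, b} : Finset V) ∈ K

/-- `a`, `b`, `c` are the three distinct corners of a triangle of `K`. -/
def IsTriangle (K : PreAbstractSimplicialComplex V) (a b c : V) : Prop :=
  a ≠ b ∧ a ≠ c ∧ b ≠ c ∧ ({a, b, c} : Finset V) ∈ K

/-- The faces of the link of the vertex `v` in `K`. -/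
def linkFaces (K : PreAbstractSimplicialComplex V) (v : V) : Set (Finset V) :=
  {s | s.Nonempty ∧ v ∉ s ∧ insert v s ∈ K}

/-- `v` is an interior vertex: its link is a cycle `j 0, j 1, …, j (n - 1), j 0` with `n ≥ 3`. -/
def IsInteriorVertex (K : PreAbstractSimplicialComplex V) (v : V) : Prop :=
  ∃ n : ℕ, 3 ≤ n ∧ ∃ j : ZMod n → V, Function.Injective j ∧
    linkFaces K v = {s | ∃ k : ZMod n, s = {j k} ∨ s = {j k, j (k + 1)}}

/-- The link of `v` is a path `j 0, j 1, …, j n` with `n ≥ 1` edges. -/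
def HasPathLink (K : PreAbstractSimplicialComplex V) (v : V) : Prop :=
  ∃ n : ℕ, 1 ≤ n ∧ ∃ j : Fin (n + 1) → V, Function.Injective j ∧
    linkFaces K v =
      {s | (∃ k : Fin (n + 1), s = {j k}) ∨ ∃ k : Fin n, s = {j k.castSucc, j k.succ}}

/-- `K` is a triangulation of a surface with or without boundary: the link of every vertex is a
cycle (interior vertices) or a path (boundary vertices). -/
def IsTriangulatedSurface (K : PreAbstractSimplicialComplex V) : Prop :=
  ∀ v ∈ vertexSet K, IsInteriorVertex K v ∨ HasPathLink K v

/-- The vertices on the boundary: those which are not interior. -/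
def boundaryVertexSet (K : PreAbstractSimplicialComplex V) : Set V :=
  {v | v ∈ vertexSet K ∧ ¬ IsInteriorVertex K v}

/-- The `1`-ring neighbourhood of `i`: all faces containing `i`, together with their faces. -/
def oneRing (K : PreAbstractSimplicialComplex V) (i : V) : PreAbstractSimplicialComplex V where
  faces := {s | s.Nonempty ∧ insert i s ∈ K}
  isRelLowerSet_faces := by
    rintro s ⟨hs, his⟩
    refine ⟨hs, fun t hts ht => ⟨ht, ?_⟩⟩
    exact (K.isRelLowerSet_faces his).2 (Finset.insert_subset_insert i hts)
      (Finset.insert_nonempty i t)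

/-- The underlying space `|K|`, in barycentric coordinates. -/
def realization (K : PreAbstractSimplicialComplex V) : Set (V → ℝ) :=
  {x | ∃ s ∈ K, (∀ v, v ∉ s → x v = 0) ∧ (∀ v, 0 ≤ x v) ∧ ∑ v ∈ s, x v = 1}

/-- The vertex `v` as a point of the underlying space. -/
def vertexPoint (v : V) : V → ℝ := Pi.single v 1

/-- `φ` restricted to `|K|` is a hyperbolic geodesic embedding into the Poincaré disc: a
homeomorphism onto its image which maps each edge to the hyperbolic geodesic segment joining the
images of its end points. (The values of `φ` off `|K|` play no role.) -/
def IsHypGeodesicEmbedding (K : PreAbstractSimplicialComplex V)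
    (φ : (V → ℝ) → Complex.UnitDisc) : Prop :=
  Topology.IsEmbedding ((realization K).domRestrict φ) ∧
    ∀ a b : V, IsEdge K a b →
      φ '' segment ℝ (vertexPoint a) (vertexPoint b) =
        hypSegment (φ (vertexPoint a)) (φ (vertexPoint b))

/-- The embedding is Delaunay: for all adjacent triangles `a b c` and `a b d`, the point `d` is not
in the interior of the Euclidean circle circumscribed about `a b c`. -/
def IsHypDelaunay (K : PreAbstractSimplicialComplex V)
    (φ : (V → ℝ) → Complex.UnitDisc) : Prop :=
  ∀ a b c d : V, IsTriangle K a b c → IsTriangle K a b d → c ≠ d →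
    ∀ (o : ℂ) (r : ℝ), ‖(φ (vertexPoint a) : ℂ) - o‖ = r → ‖(φ (vertexPoint b) : ℂ) - o‖ = r →
      ‖(φ (vertexPoint c) : ℂ) - o‖ = r → r ≤ ‖(φ (vertexPoint d) : ℂ) - o‖

/-- The length function induced on the edges by `φ`, through the hyperbolic distance. -/
noncomputable def inducedLength (φ : (V → ℝ) → Complex.UnitDisc) (a b : V) : ℝ :=
  hypDist (φ (vertexPoint a)) (φ (vertexPoint b))

/-- `l' = u *ʰ l` on `K`: the lengths `l` and `l'` are hyperbolic discrete conformal with hyperbolic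
conformal factor `u`. -/
def IsHypConformal (K : PreAbstractSimplicialComplex V) (l l' : V → V → ℝ) (u : V → ℝ) : Prop :=
  ∀ a b : V, IsEdge K a b →
    Real.sinh (l' a b / 2) = Real.exp ((u a + u b) / 2) * Real.sinh (l a b / 2)

end Combinatorics

/-! Everything reduces to one claim: if `u i ≤ 0` and `u i` is minimal among the values at the link
vertices, then `u` vanishes on the one-ring. A minimum of `u` and `0` attained only away from the
centre is already seen on the boundary, or is `0`.

For the claim, move the centre to the origin by a disc automorphism and invert in the unit circle
(`farPoint`). With `S = sinh² (l / 2)`, the link vertices become corners of a Euclidean polygon with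
squared spokes `1 + 1 / S i j` and squared sides `S j k / (S i j * S i k)`. A conformal change
multiplies every side by the same factor `exp (-u i)`. After scaling the second polygon by `c = exp
(u i) ≤ 1`, the sides agree and the squared spokes become `c² + (c / exp (u j)) / S i j`, which are
no longer than the first ones. Equality of all spokes forces `c = 1` and `u j = 0`.

It remains to show rigidity (`IsConvexFan.eq_of_le`): two convex polygons around the origin with
equal sides, one with spokes no longer than the other's, have equal spokes. Interpolate the squared
spokes linearly. The total angle at the origin is `2π` at both ends, so by Rolle its derivative
vanishes somewhere. That derivative is a sum of terms (shortening of the spoke) × (sum of the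
cotangents of the two base angles at the corner), all nonnegative by convexity. So every corner
whose spoke shrinks is flat. Then the difference of squared spokes is harmonic where positive, hence
zero or positive everywhere; the latter would make all corners flat, which is absurd.

Two facts make the polygons convex fans. In the Klein model the embedding is straight; a winding
argument shows that each triangle covers its straight image, so injectivity makes the sectors at the
centre disjoint and their angles sum to `2π` (`fan_of_disjoint`). The Delaunay condition, read after
an inversion centred at the image of `i`, only controls corners relative to the centre of inversion,
which need not be the origin; `convex_of_star` upgrades this to convexity. -/

/-! ### Rigidity of convex fans with prescribed sides. -/

/-- The squared area, up to the factor `16`, of the triangle with squared side lengths `x`, `y`,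
`L`. -/
def heron (L x y : ℝ) : ℝ := 2 * L * (x + y) - L ^ 2 - (x - y) ^ 2

/-- The angle between two sides of squared lengths `x` and `y` of a triangle whose third side has
squared length `L`. -/
noncomputable def apexAngle (L x y : ℝ) : ℝ := Real.arccos ((x + y - L) / (2 * Real.sqrt (x * y)))

/-- For fixed `L` the Heron polynomial is concave in `(x, y)`, so interpolating squared sides
linearly keeps triangles nondegenerate. -/
lemma heron_segment_pos {L x y x' y' t : ℝ} (h : 0 < heron L x y) (h' : 0 < heron L x' y')
    (h0 : 0 ≤ t) (h1 : t ≤ 1) :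
    0 < heron L (x + t * (x' - x)) (y + t * (y' - y)) := by
  unfold heron at *
  have key : (2 * L * (x + t * (x' - x) + (y + t * (y' - y))) - L ^ 2 -
      (x + t * (x' - x) - (y + t * (y' - y))) ^ 2) =
      (1 - t) * (2 * L * (x + y) - L ^ 2 - (x - y) ^ 2) +
      t * (2 * L * (x' + y') - L ^ 2 - (x' - y') ^ 2) +
      t * (1 - t) * ((x - y) - (x' - y')) ^ 2 := by ring
  rw [key]
  have e : 0 ≤ t * (1 - t) * ((x - y) - (x' - y')) ^ 2 :=
    mul_nonneg (mul_nonneg h0 (by linarith)) (sq_nonneg _)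
  rcases eq_or_lt_of_le h0 with rfl | h0
  · nlinarith
  · have := mul_pos h0 h'
    have := mul_nonneg (sub_nonneg.2 h1) h.le
    linarith

/-- Since `√heron` is four times the area, `(x - y + L) / √heron` is the cotangent of the base angle
at the end of the side `√x`: the derivative weighs `a / (2x)` and `b / (2y)` with the cotangents of
the base angles. -/
lemma hasDerivAt_apexAngle {L a b : ℝ} {x y : ℝ → ℝ} {t : ℝ} (hx : HasDerivAt x a t)
    (hy : HasDerivAt y b t) (x0 : 0 < x t) (y0 : 0 < y t) (hG : 0 < heron L (x t) (y t)) :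
    HasDerivAt (fun τ => apexAngle L (x τ) (y τ))
      (-(a * ((x t - y t + L) / (2 * x t)) + b * ((y t - x t + L) / (2 * y t))) /
        Real.sqrt (heron L (x t) (y t))) t := by
  unfold apexAngle
  set X := x t with hX
  set Y := y t with hY
  have xy : 0 < X * Y := mul_pos x0 y0
  set r := Real.sqrt (X * Y) with hr
  have r0 : 0 < r := Real.sqrt_pos.2 xy
  have r2 : r ^ 2 = X * Y := Real.sq_sqrt xy.le
  set g := Real.sqrt (heron L X Y) with hg
  have g0 : 0 < g := Real.sqrt_pos.2 hG
  have g2 : g ^ 2 = heron L X Y := Real.sq_sqrt hG.le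
  have h1 : HasDerivAt (fun τ => Real.sqrt (x τ * y τ)) ((a * Y + X * b) / (2 * r)) t :=
    (hx.mul hy).sqrt xy.ne'
  have h2 : HasDerivAt (fun τ => (x τ + y τ - L) / (2 * Real.sqrt (x τ * y τ)))
      (((a + b) * (2 * r) - (X + Y - L) * (2 * ((a * Y + X * b) / (2 * r)))) / (2 * r) ^ 2) t :=
    (((hx.add hy).sub_const L).div (h1.const_mul 2) (by positivity))
  have hc : 1 - ((X + Y - L) / (2 * r)) ^ 2 = (g / (2 * r)) ^ 2 := by
    rw [div_pow, div_pow, g2, mul_pow, r2]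
    unfold heron
    field_simp
    ring
  have hpos : 0 < 1 - ((X + Y - L) / (2 * r)) ^ 2 := by rw [hc]; positivity
  have h3 := (Real.hasDerivAt_arccos (x := (X + Y - L) / (2 * r)) (by rintro h; rw [h] at hpos; norm_num at hpos)
    (by rintro h; rw [h] at hpos; norm_num at hpos)).comp t h2
  refine h3.congr_deriv ?_
  rw [hc, Real.sqrt_sq (by positivity)]
  have : r ^ 2 ≠ 0 := by positivity
  field_simp
  rw [r2]
  field_simp
  ring

/-- With `(A, g) = √S (cos α, sin α)` and `(B, h) = √S (cos β, sin β)` this is `sin (α + β) (sin α +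
sin β) = (cos α + cos β) (1 - cos (α + β))`. It compares the signs of `α + β ≤ π` expressed by sine,
cosines or cotangents without mentioning angles. -/
lemma mul_add_mul_mul_add {A B g h S : ℝ} (h1 : A ^ 2 + g ^ 2 = S) (h2 : B ^ 2 + h ^ 2 = S) :
    (A * h + B * g) * (g + h) = (A + B) * (g * h + S - A * B) := by
  have e1 : S = A ^ 2 + g ^ 2 := h1.symm
  have e2 : h ^ 2 = A ^ 2 + g ^ 2 - B ^ 2 := by linarith
  rw [e1]
  linear_combination A * e2

lemma mul_add_sub_mul_pos {A B g h S : ℝ} (hg : 0 < g) (hh : 0 < h) (h1 : A ^ 2 + g ^ 2 = S)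
    (h2 : B ^ 2 + h ^ 2 = S) : 0 < g * h + S - A * B := by
  nlinarith [mul_pos hg hh, sq_nonneg (A - B), sq_nonneg g, sq_nonneg h]

/-- The sum of the cosines of two angles in `(0, π)` has the same sign as the sum of their
cotangents. -/
lemma div_add_div_nonneg_of_sq {A B g h S : ℝ} (hg : 0 < g) (hh : 0 < h) (h1 : A ^ 2 + g ^ 2 = S)
    (h2 : B ^ 2 + h ^ 2 = S) (hAB : 0 ≤ A + B) :
    0 ≤ A / g + B / h ∧ (A / g + B / h = 0 → A + B = 0) := by
  have e : A / g + B / h = (A * h + B * g) / (g * h) := by field_simp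
  have key := mul_add_mul_mul_add h1 h2
  have pos := mul_add_sub_mul_pos hg hh h1 h2
  constructor
  · rw [e]
    refine div_nonneg ?_ (by positivity)
    refine nonneg_of_mul_nonneg_left ?_ (add_pos hg hh)
    rw [key]
    exact mul_nonneg hAB pos.le
  · intro h0
    rw [e, div_eq_zero_iff, or_iff_left (by positivity)] at h0
    rw [h0, zero_mul] at key
    exact (mul_eq_zero.1 key.symm).resolve_right pos.ne'

lemma add_nonneg_of_mul_add_mul_nonneg {A B g h S : ℝ} (hg : 0 < g) (hh : 0 < h)
    (h1 : A ^ 2 + g ^ 2 = S) (h2 : B ^ 2 + h ^ 2 = S) (hAB : 0 ≤ A * h + B * g) : 0 ≤ A + B := by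
  have key := mul_add_mul_mul_add h1 h2
  refine nonneg_of_mul_nonneg_left ?_ (mul_add_sub_mul_pos hg hh h1 h2)
  rw [← key]
  exact mul_nonneg hAB (add_pos hg hh).le

/-- The data of a polygon with side lengths `l k` which is convex at each corner and sees the
origin under the total angle `2π`; `s k` is the squared distance of the corner `k` to the origin. -/
structure IsConvexFan {n : ℕ} [NeZero n] (l s : ZMod n → ℝ) : Prop where
  pos : ∀ k, 0 < s k
  heron_pos : ∀ k, 0 < heron (l k ^ 2) (s k) (s (k + 1))
  convex : ∀ k, 0 ≤ (s k - s (k + 1) + l k ^ 2) / l k + (s k - s (k - 1) + l (k - 1) ^ 2) / l (k - 1)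
  sum_angle : ∑ k, apexAngle (l k ^ 2) (s k) (s (k + 1)) = 2 * Real.pi

lemma sum_shift {n : ℕ} [NeZero n] (f : ZMod n → ℝ) : ∑ k, f (k - 1) = ∑ k, f k :=
  (Equiv.subRight (1 : ZMod n)).sum_comp f

/-- A nonnegative function on a cycle which is harmonic where it is positive vanishes, unless it is
positive everywhere. -/
lemma eq_zero_or_forall_pos_of_harmonic {n : ℕ} [NeZero n] {l d : ZMod n → ℝ} (hl : ∀ k, 0 < l k)
    (hd : ∀ k, 0 ≤ d k)
    (h : ∀ k, 0 < d k → (d k - d (k + 1)) / l k + (d k - d (k - 1)) / l (k - 1) = 0) :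
    (∀ k, d k = 0) ∨ ∀ k, 0 < d k := by
  obtain ⟨m, hm⟩ := Finite.exists_max d
  rcases (hd m).eq_or_lt with h0 | h0
  · exact Or.inl fun k => le_antisymm (h0 ▸ hm k) (hd k)
  · right
    -- Maximum principle: at a maximum both difference quotients are nonnegative and sum to zero, so
    -- the next neighbour has the same value.
    have step : ∀ j : ℕ, d (m + j) = d m := by
      intro j
      induction j with
      | zero => simp
      | succ j ih =>
        have e := h (m + j) (ih ▸ h0)
        have p1 : 0 ≤ (d (m + j) - d (m + j + 1)) / l (m + j) :=
          div_nonneg (by rw [ih]; linarith [hm (m + j + 1)]) (hl _).le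
        have p2 : 0 ≤ (d (m + j) - d (m + j - 1)) / l (m + j - 1) :=
          div_nonneg (by rw [ih]; linarith [hm (m + j - 1)]) (hl _).le
        have p3 : (d (m + j) - d (m + j + 1)) / l (m + j) = 0 := by linarith
        rw [div_eq_zero_iff, or_iff_left (hl _).ne'] at p3
        push_cast
        rw [← add_assoc]
        linarith
    intro k
    have := step (k - m).val
    rw [ZMod.natCast_zmod_val, add_sub_cancel] at this
    rwa [this]

/-- Two convex fans with the same side lengths, one of them with shorter spokes, have the same
spokes. -/
theorem IsConvexFan.eq_of_le {n : ℕ} [NeZero n] {l s s' : ZMod n → ℝ} (hl : ∀ k, 0 < l k)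
    (h : IsConvexFan l s) (h' : IsConvexFan l s') (hle : ∀ k, s' k ≤ s k) : s' = s := by
  set σ : ℝ → ZMod n → ℝ := fun t k => s k + t * (s' k - s k) with hσ
  set G : ℝ → ZMod n → ℝ := fun t k => heron (l k ^ 2) (σ t k) (σ t (k + 1)) with hG
  have σpos : ∀ t ∈ Set.Icc (0 : ℝ) 1, ∀ k, 0 < σ t k := by
    intro t ht k
    have e : σ t k = (1 - t) * s k + t * s' k := by simp only [hσ]; ring
    rw [e]
    rcases eq_or_lt_of_le ht.1 with rfl | h0
    · simpa using h.pos k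
    · have := mul_pos h0 (h'.pos k)
      have := mul_nonneg (sub_nonneg.2 ht.2) (h.pos k).le
      linarith
  have Gpos : ∀ t ∈ Set.Icc (0 : ℝ) 1, ∀ k, 0 < G t k := fun t ht k =>
    heron_segment_pos (h.heron_pos k) (h'.heron_pos k) ht.1 ht.2
  set Θ : ℝ → ℝ := fun t => ∑ k, apexAngle (l k ^ 2) (σ t k) (σ t (k + 1)) with hΘ
  have hder : ∀ k t, HasDerivAt (fun τ => σ τ k) (s' k - s k) t := fun k t => by
    simpa [hσ] using ((hasDerivAt_id t).mul_const (s' k - s k)).const_add (s k)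
  set D : ℝ → ℝ := fun t => ∑ k,
    (-((s' k - s k) * ((σ t k - σ t (k + 1) + l k ^ 2) / (2 * σ t k)) +
      (s' (k + 1) - s (k + 1)) * ((σ t (k + 1) - σ t k + l k ^ 2) / (2 * σ t (k + 1)))) /
        Real.sqrt (G t k)) with hD
  have hΘder : ∀ t ∈ Set.Icc (0 : ℝ) 1, HasDerivAt Θ (D t) t := by
    intro t ht
    refine HasDerivAt.fun_sum fun k _ => ?_
    exact hasDerivAt_apexAngle (hder k t) (hder (k + 1) t) (σpos t ht k) (σpos t ht (k + 1))
      (Gpos t ht k)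
  -- Rolle: the total angle is `2π` at both ends.
  obtain ⟨t, ht, hDt⟩ : ∃ t ∈ Set.Ioo (0 : ℝ) 1, D t = 0 := by
    refine exists_hasDerivAt_eq_zero zero_lt_one
      (fun t ht => (hΘder t ht).continuousAt.continuousWithinAt) ?_
      (fun t ht => hΘder t ⟨ht.1.le, ht.2.le⟩)
    have e0 : Θ 0 = 2 * Real.pi := by simpa [hΘ, hσ] using h.sum_angle
    have e1 : Θ 1 = 2 * Real.pi := by simpa [hΘ, hσ] using h'.sum_angle
    rw [e0, e1]
  have htc : t ∈ Set.Icc (0 : ℝ) 1 := ⟨ht.1.le, ht.2.le⟩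
  -- `A k` and `B k` are `2 √(σ t k)` times the cosines of the base angles at corner `k`; `g k` and
  -- `g (k - 1)` are the matching sines.
  set A : ZMod n → ℝ := fun k => (σ t k - σ t (k + 1) + l k ^ 2) / l k with hA
  set B : ZMod n → ℝ := fun k => (σ t k - σ t (k - 1) + l (k - 1) ^ 2) / l (k - 1) with hB
  set g : ZMod n → ℝ := fun k => Real.sqrt (G t k) / l k with hg
  have gpos : ∀ k, 0 < g k := fun k => div_pos (Real.sqrt_pos.2 (Gpos t htc k)) (hl k)
  have hsq1 : ∀ k, A k ^ 2 + g k ^ 2 = 4 * σ t k := by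
    intro k
    simp only [hA, hg, div_pow]
    rw [Real.sq_sqrt (Gpos t htc k).le, ← add_div, div_eq_iff (pow_pos (hl k) 2).ne']
    simp only [hG, heron]
    ring
  have hsq2 : ∀ k, B k ^ 2 + g (k - 1) ^ 2 = 4 * σ t k := by
    intro k
    simp only [hB, hg, div_pow]
    rw [Real.sq_sqrt (Gpos t htc (k - 1)).le, ← add_div, div_eq_iff (pow_pos (hl _) 2).ne']
    simp only [hG, heron, sub_add_cancel]
    ring
  -- The convexity expression is affine in the squared spokes; this is why those are the quantities
  -- interpolated.
  have hconv : ∀ k, A k + B k = (1 - t) *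
        ((s k - s (k + 1) + l k ^ 2) / l k + (s k - s (k - 1) + l (k - 1) ^ 2) / l (k - 1)) + t *
        ((s' k - s' (k + 1) + l k ^ 2) / l k + (s' k - s' (k - 1) + l (k - 1) ^ 2) / l (k - 1)) := by
    intro k
    simp only [hA, hB, hσ]
    have := (hl k).ne'
    have := (hl (k - 1)).ne'
    field_simp
    ring
  have t1 : 0 < 1 - t := by linarith [ht.2]
  have hAB : ∀ k, 0 ≤ A k + B k := fun k => by
    rw [hconv]
    exact add_nonneg (mul_nonneg t1.le (h.convex k)) (mul_nonneg ht.1.le (h'.convex k))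
  have hcot := fun k => div_add_div_nonneg_of_sq (gpos k) (gpos (k - 1)) (hsq1 k) (hsq2 k) (hAB k)
  -- Regroup the derivative from a sum over triangles to a sum over corners.
  have hsum : D t = ∑ k, (s k - s' k) / (2 * σ t k) * (A k / g k + B k / g (k - 1)) := by
    have e1 : ∀ k, A k / g k = (σ t k - σ t (k + 1) + l k ^ 2) / Real.sqrt (G t k) := fun k =>
      div_div_div_cancel_right₀ (hl k).ne' _ _
    have e2 : ∀ k, B k / g (k - 1) =
        (σ t k - σ t (k - 1) + l (k - 1) ^ 2) / Real.sqrt (G t (k - 1)) := fun k =>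
      div_div_div_cancel_right₀ (hl _).ne' _ _
    have e3 : ∑ k, (s k - s' k) / (2 * σ t k) * (A k / g k + B k / g (k - 1)) =
        ∑ k, (s k - s' k) / (2 * σ t k) * (A k / g k) +
        ∑ k, (s (k + 1) - s' (k + 1)) / (2 * σ t (k + 1)) * (B (k + 1) / g k) := by
      rw [← sum_shift fun k => (s (k + 1) - s' (k + 1)) / (2 * σ t (k + 1)) * (B (k + 1) / g k),
        ← Finset.sum_add_distrib]
      refine Finset.sum_congr rfl fun k _ => ?_
      simp only [sub_add_cancel, mul_add]
    rw [e3, ← Finset.sum_add_distrib]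
    refine Finset.sum_congr rfl fun k _ => ?_
    have e4 := e2 (k + 1)
    rw [add_sub_cancel_right] at e4
    rw [e1, e4]
    ring
  have hterm : ∀ k, (s k - s' k) / (2 * σ t k) * (A k / g k + B k / g (k - 1)) = 0 := by
    intro k
    refine (Finset.sum_eq_zero_iff_of_nonneg fun k _ => ?_).1 (hsum ▸ hDt) k (Finset.mem_univ k)
    have := σpos t htc k
    exact mul_nonneg (div_nonneg (by linarith [hle k]) (by linarith)) (hcot k).1
  have hflat : ∀ k, 0 < s k - s' k →
      (s k - s (k + 1) + l k ^ 2) / l k + (s k - s (k - 1) + l (k - 1) ^ 2) / l (k - 1) = 0 ∧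
      (s' k - s' (k + 1) + l k ^ 2) / l k + (s' k - s' (k - 1) + l (k - 1) ^ 2) / l (k - 1) = 0 := by
    intro k hk
    have hs := σpos t htc k
    have h0 := (hcot k).2 ((mul_eq_zero.1 (hterm k)).resolve_left (by positivity))
    rw [hconv, add_eq_zero_iff_of_nonneg (mul_nonneg t1.le (h.convex k))
      (mul_nonneg ht.1.le (h'.convex k))] at h0
    exact ⟨(mul_eq_zero.1 h0.1).resolve_left t1.ne', (mul_eq_zero.1 h0.2).resolve_left ht.1.ne'⟩
  rcases eq_zero_or_forall_pos_of_harmonic (d := fun k => s k - s' k) hl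
    (fun k => sub_nonneg.2 (hle k)) (fun k hk => by
      obtain ⟨f1, f2⟩ := hflat k hk
      have f3 := congrArg₂ (· - ·) f1 f2
      simp only [sub_zero] at f3
      rw [← f3]
      ring) with hz | hp
  · funext k
    linarith [hz k]
  · exfalso
    -- Regrouped by edges, the spokes cancel and each edge contributes `2 * l k > 0`: a closed
    -- polygon cannot be flat at every corner.
    have z : ∑ k, ((s k - s (k + 1) + l k ^ 2) / l k +
        (s k - s (k - 1) + l (k - 1) ^ 2) / l (k - 1)) = 0 :=
      Finset.sum_eq_zero fun k _ => (hflat k (hp k)).1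
    have shift := sum_shift fun k => (s (k + 1) - s k + l k ^ 2) / l k
    simp only [sub_add_cancel] at shift
    rw [Finset.sum_add_distrib, shift, ← Finset.sum_add_distrib] at z
    have pos : 0 < ∑ k, ((s k - s (k + 1) + l k ^ 2) / l k + (s (k + 1) - s k + l k ^ 2) / l k) := by
      refine Finset.sum_pos (fun k _ => ?_) Finset.univ_nonempty
      rw [← add_div]
      exact div_pos (by have := pow_pos (hl k) 2; linarith) (hl k)
    exact pos.ne' z

/-! ### Plane polygons star-shaped about a point. -/

/-- The oriented area of the parallelogram spanned by `a` and `b`. -/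
def cross (a b : ℂ) : ℝ := a.re * b.im - a.im * b.re

lemma cross_swap (a b : ℂ) : cross b a = -cross a b := by unfold cross; ring

lemma cross_conj (a b : ℂ) : cross (starRingEnd ℂ a) (starRingEnd ℂ b) = -cross a b := by
  simp [cross]; ring

lemma cross_real_smul (c d : ℝ) (a b : ℂ) : cross (c * a) (d * b) = c * d * cross a b := by
  simp [cross]; ring

lemma apexAngle_eq_angle {a b : ℂ} (ha : a ≠ 0) (hb : b ≠ 0) :
    apexAngle (‖a - b‖ ^ 2) (‖a‖ ^ 2) (‖b‖ ^ 2) = InnerProductGeometry.angle a b := by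
  have h1 : 0 < ‖a‖ := norm_pos_iff.2 ha
  have h2 : 0 < ‖b‖ := norm_pos_iff.2 hb
  have e : Real.sqrt (‖a‖ ^ 2 * ‖b‖ ^ 2) = ‖a‖ * ‖b‖ := by
    rw [← mul_pow, Real.sqrt_sq (by positivity)]
  unfold apexAngle InnerProductGeometry.angle
  rw [e, norm_sub_sq_real]
  congr 1
  field_simp
  ring

lemma heron_eq_cross (a b : ℂ) : heron (‖a - b‖ ^ 2) (‖a‖ ^ 2) (‖b‖ ^ 2) = 4 * cross a b ^ 2 := by
  simp only [heron, cross, Complex.sq_norm, Complex.normSq_apply, Complex.sub_re, Complex.sub_im]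
  ring

/-- The base angles at `b` add up to at most `π` exactly when the corner turns left: the sine of
their sum is a positive multiple of `cross (b - a) (c - b)`, and positive sines turn this into the
sign of the cosine sum. -/
lemma convex_corner {a b c : ℂ} (h1 : 0 < cross a b) (h2 : 0 < cross b c)
    (h : 0 ≤ cross (b - a) (c - b)) :
    0 ≤ (‖b‖ ^ 2 - ‖c‖ ^ 2 + ‖b - c‖ ^ 2) / ‖b - c‖ + (‖b‖ ^ 2 - ‖a‖ ^ 2 + ‖a - b‖ ^ 2) / ‖a - b‖ := by
  have hbc : 0 < ‖b - c‖ := norm_pos_iff.2 (sub_ne_zero.2 (by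
    rintro rfl; simp [cross, mul_comm] at h2))
  have hab : 0 < ‖a - b‖ := norm_pos_iff.2 (sub_ne_zero.2 (by
    rintro rfl; simp [cross, mul_comm] at h1))
  have aux : ∀ L A g : ℝ, 0 < L → A ^ 2 + g ^ 2 = 4 * ‖b‖ ^ 2 * L ^ 2 →
      (A / L) ^ 2 + (g / L) ^ 2 = 4 * ‖b‖ ^ 2 := fun L A g hL h => by
    field_simp; linarith
  refine add_nonneg_of_mul_add_mul_nonneg (g := 2 * cross b c / ‖b - c‖)
    (h := 2 * cross a b / ‖a - b‖) (S := 4 * ‖b‖ ^ 2) (by positivity) (by positivity)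
    (aux _ _ _ hbc ?_) (aux _ _ _ hab ?_) ?_
  · simp only [cross, Complex.sq_norm, Complex.normSq_apply, Complex.sub_re, Complex.sub_im]
    ring
  · simp only [cross, Complex.sq_norm, Complex.normSq_apply, Complex.sub_re, Complex.sub_im]
    ring
  · have e : (‖b‖ ^ 2 - ‖c‖ ^ 2 + ‖b - c‖ ^ 2) / ‖b - c‖ * (2 * cross a b / ‖a - b‖) +
        (‖b‖ ^ 2 - ‖a‖ ^ 2 + ‖a - b‖ ^ 2) / ‖a - b‖ * (2 * cross b c / ‖b - c‖) =
        4 * ‖b‖ ^ 2 * cross (b - a) (c - b) / (‖a - b‖ * ‖b - c‖) := by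
      field_simp
      simp only [cross, Complex.sq_norm, Complex.normSq_apply, Complex.sub_re, Complex.sub_im]
      ring
    rw [e]
    positivity

lemma isConvexFan_of_cross {n : ℕ} [NeZero n] {w : ZMod n → ℂ}
    (h : ∀ k, 0 < cross (w k) (w (k + 1)))
    (hX : ∀ k, 0 ≤ cross (w k - w (k - 1)) (w (k + 1) - w k))
    (hsum : ∑ k, InnerProductGeometry.angle (w k) (w (k + 1)) = 2 * Real.pi) :
    IsConvexFan (fun k => ‖w k - w (k + 1)‖) (fun k => ‖w k‖ ^ 2) := by
  have h0 : ∀ k, w k ≠ 0 := fun k hk => by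
    have := h k
    simp [hk, cross] at this
  refine ⟨fun k => ?_, fun k => ?_, fun k => ?_, ?_⟩
  · have := norm_pos_iff.2 (h0 k)
    positivity
  · rw [heron_eq_cross]
    have := h k
    positivity
  · have h1 := h (k - 1)
    rw [sub_add_cancel] at h1
    have := convex_corner h1 (h k) (hX k)
    simpa only [sub_add_cancel] using this
  · rw [← hsum]
    exact Finset.sum_congr rfl fun k _ => apexAngle_eq_angle (h0 _) (h0 _)

/-- A real function cannot increase forever along a cycle. -/
lemma not_forall_lt_add {n : ℕ} [NeZero n] {f : ZMod n → ℝ} {c m : ZMod n}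
    (h : ∀ j : ℕ, f (m + j * c) < f (m + (j + 1 : ℕ) * c)) : False := by
  have : StrictMono fun j : ℕ => f (m + j * c) := strictMono_nat_of_lt_succ h
  have := this (NeZero.pos n)
  simp at this

lemma cross_corner (a b c q : ℂ) :
    cross (a - q) (b - q) * cross b c =
      cross (b - q) (c - q) * cross a b - cross (b - a) (c - b) * cross q b := by
  simp only [cross, Complex.sub_re, Complex.sub_im]
  ring

/-- If a polygon is star-shaped about the origin, then it is star-shaped about every point `q`
such that each corner is convex or reflex according to the side of `q` with respect to the adjacent
edges. -/
lemma cross_sub_nonneg_of_star {n : ℕ} [NeZero n] {w : ZMod n → ℂ} {q : ℂ}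
    (h : ∀ k, 0 < cross (w k) (w (k + 1)))
    (h1 : ∀ k, 0 ≤ cross (w k - q) (w (k + 1) - q) * cross (w k - w (k - 1)) (w (k + 1) - w k))
    (h2 : ∀ k, 0 ≤ cross (w (k - 1) - q) (w k - q) * cross (w k - w (k - 1)) (w (k + 1) - w k))
    (k : ZMod n) : 0 ≤ cross (w k - q) (w (k + 1) - q) := by
  by_contra! hk
  have step : ∀ k, cross (w k - q) (w (k + 1) - q) < 0 → cross q (w k) < cross q (w (k + 1)) := by
    intro k hk
    have := h k
    simp only [cross, Complex.sub_re, Complex.sub_im] at *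
    linarith
  have fwd : ∀ k, cross (w k - q) (w (k + 1) - q) < 0 → 0 ≤ cross q (w (k + 1)) →
      cross (w (k + 1) - q) (w (k + 1 + 1) - q) < 0 := by
    intro k hk hf
    by_contra! hk'
    have hX := h2 (k + 1)
    have key := cross_corner (w k) (w (k + 1)) (w (k + 1 + 1)) q
    rw [add_sub_cancel_right] at hX
    have hX' := nonpos_of_mul_nonneg_right hX hk
    have p1 := mul_neg_of_neg_of_pos hk (h (k + 1))
    have p2 := mul_nonneg hk' (h k).le
    have p3 := mul_nonpos_of_nonpos_of_nonneg hX' hf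
    linarith
  have bwd : ∀ k, cross (w k - q) (w (k + 1) - q) < 0 → cross q (w k) ≤ 0 →
      cross (w (k - 1) - q) (w k - q) < 0 := by
    intro k hk hf
    by_contra! hk'
    have key := cross_corner (w (k - 1)) (w k) (w (k + 1)) q
    have e := h (k - 1)
    rw [sub_add_cancel] at e
    have hX' := nonpos_of_mul_nonneg_right (h1 k) hk
    have p1 := mul_neg_of_neg_of_pos hk e
    have p2 := mul_nonneg hk' (h k).le
    have p3 := mul_nonneg_of_nonpos_of_nonpos hX' hf
    linarith
  rcases le_total 0 (cross q (w (k + 1))) with h0 | h0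
  · have all : ∀ j : ℕ, cross (w (k + j) - q) (w (k + j + 1) - q) < 0 ∧
        0 ≤ cross q (w (k + j + 1)) := by
      intro j
      induction j with
      | zero => simpa using ⟨hk, h0⟩
      | succ j ih =>
        have := fwd _ ih.1 ih.2
        push_cast
        rw [← add_assoc]
        exact ⟨this, ih.2.trans (step _ this).le⟩
    refine not_forall_lt_add (f := fun k => cross q (w k)) (c := 1) (m := k) fun j => ?_
    have := step _ (all j).1
    push_cast
    simpa [add_assoc] using this
  · have all : ∀ j : ℕ, cross (w (k - j) - q) (w (k - j + 1) - q) < 0 ∧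
        cross q (w (k - j)) ≤ 0 := by
      intro j
      induction j with
      | zero => simpa using ⟨hk, (step k hk).le.trans h0⟩
      | succ j ih =>
        have := bwd _ ih.1 ih.2
        push_cast
        rw [← sub_sub, sub_add_cancel]
        refine ⟨this, ?_⟩
        have := step (k - j - 1) (by rwa [sub_add_cancel])
        rw [sub_add_cancel] at this
        exact this.le.trans ih.2
    refine not_forall_lt_add (f := fun k => -cross q (w k)) (c := -1) (m := k + 1) fun j => ?_
    have := step _ (all j).1
    push_cast
    have e1 : k + 1 + (j : ZMod n) * -1 = k - j + 1 := by ring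
    have e2 : k + 1 + ((j : ZMod n) + 1) * -1 = k - j := by ring
    rw [e1, e2]
    linarith

/-- Star-shapedness about `q` fixes the sign in the hypotheses unless `q` lies on the lines of both
adjacent edges; since `q` is not the corner, those lines then coincide and the corner is flat. -/
lemma convex_of_star {n : ℕ} [NeZero n] {w : ZMod n → ℂ} {q : ℂ} (hq : ∀ k, w k ≠ q)
    (h : ∀ k, 0 < cross (w k) (w (k + 1)))
    (h1 : ∀ k, 0 ≤ cross (w k - q) (w (k + 1) - q) * cross (w k - w (k - 1)) (w (k + 1) - w k))
    (h2 : ∀ k, 0 ≤ cross (w (k - 1) - q) (w k - q) * cross (w k - w (k - 1)) (w (k + 1) - w k))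
    (k : ZMod n) : 0 ≤ cross (w k - w (k - 1)) (w (k + 1) - w k) := by
  have c1 := cross_sub_nonneg_of_star h h1 h2 k
  have c2 := cross_sub_nonneg_of_star h h1 h2 (k - 1)
  rw [sub_add_cancel] at c2
  rcases c1.eq_or_lt with z1 | p1
  · rcases c2.eq_or_lt with z2 | p2
    · have hv : 0 < Complex.normSq (w k - q) := Complex.normSq_pos.2 (sub_ne_zero.2 (hq k))
      have : cross (w k - w (k - 1)) (w (k + 1) - w k) * Complex.normSq (w k - q) = 0 := by
        simp only [cross, Complex.normSq_apply, Complex.sub_re, Complex.sub_im] at *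
        linear_combination
          (((w (k + 1)).re - (w k).re) * ((w k).re - q.re) +
            ((w (k + 1)).im - (w k).im) * ((w k).im - q.im)) * z2 -
          (((w k).re - (w (k - 1)).re) * ((w k).re - q.re) +
            ((w k).im - (w (k - 1)).im) * ((w k).im - q.im)) * z1
      exact ((mul_eq_zero.1 this).resolve_right hv.ne').ge
    · exact nonneg_of_mul_nonneg_right (h2 k) p2
  · exact nonneg_of_mul_nonneg_right (h1 k) p1

/-! ### The Delaunay condition after inversion. -/

/-- Inversion in the unit circle. -/
noncomputable def invCircle (z : ℂ) : ℂ := 1 / starRingEnd ℂ z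

lemma invCircle_re (z : ℂ) : (invCircle z).re = z.re / Complex.normSq z := by
  simp [invCircle, Complex.inv_re]

lemma invCircle_im (z : ℂ) : (invCircle z).im = z.im / Complex.normSq z := by
  simp [invCircle, Complex.inv_im]

/-- The empty circle condition for the circle through `a`, `b`, `c` and the point `d`, expressed
after an inversion with centre `a`. -/
lemma delaunay_inversion {a b c d : ℂ} (hb : b ≠ a) (hc : c ≠ a) (hd : d ≠ a)
    (h : ∀ (o : ℂ) (r : ℝ), ‖a - o‖ = r → ‖b - o‖ = r → ‖c - o‖ = r → r ≤ ‖d - o‖) :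
    0 ≤ cross (invCircle (b - a)) (invCircle (c - a)) *
      cross (invCircle (c - a) - invCircle (b - a)) (invCircle (d - a) - invCircle (b - a)) := by
  set u := invCircle (b - a) with hu
  set v := invCircle (c - a) with hv
  set z := invCircle (d - a) with hz
  -- The power of `x` with respect to the circle through `a` centred at `a + m` becomes affine after
  -- inversion, so the circle becomes the line `⟨m, ·⟩ = 1 / 2` and its exterior the side containing
  -- `0`.
  have inv : ∀ x m : ℂ, x ≠ a → ‖x - (a + m)‖ ^ 2 - ‖m‖ ^ 2 =
      ‖x - a‖ ^ 2 * (1 - 2 * (m.re * (invCircle (x - a)).re + m.im * (invCircle (x - a)).im)) := by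
    intro x m hx
    have h0 : Complex.normSq (x - a) ≠ 0 := (Complex.normSq_pos.2 (sub_ne_zero.2 hx)).ne'
    rw [invCircle_re, invCircle_im, Complex.sq_norm (x - a)]
    field_simp
    simp only [Complex.sq_norm, Complex.normSq_apply, Complex.sub_re, Complex.sub_im,
      Complex.add_re, Complex.add_im]
    ring
  rcases eq_or_ne (cross u v) 0 with h0 | h0
  · simp [h0]
  -- Solution of `⟨m, u⟩ = ⟨m, v⟩ = 1 / 2`: the circumcentre is `a + m`.
  set m : ℂ := ⟨(v - u).im / (2 * cross u v), -(v - u).re / (2 * cross u v)⟩ with hm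
  have onC : ∀ x : ℂ, x ≠ a → m.re * (invCircle (x - a)).re + m.im * (invCircle (x - a)).im = 1 / 2 →
      ‖x - (a + m)‖ = ‖m‖ := by
    intro x hx hx'
    have := inv x m hx
    rw [hx'] at this
    have e : ‖x - (a + m)‖ ^ 2 = ‖m‖ ^ 2 := by linarith
    exact (sq_eq_sq₀ (norm_nonneg _) (norm_nonneg _)).1 e
  have key := h (a + m) ‖m‖ (by simp) (onC b hb ?_) (onC c hc ?_)
  · have hd0 : 0 < ‖d - a‖ ^ 2 := by
      have := norm_pos_iff.2 (sub_ne_zero.2 hd)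
      positivity
    have e := inv d m hd
    rw [← hz] at e
    have k2 := pow_le_pow_left₀ (norm_nonneg _) key 2
    have k3 : 0 ≤ 1 - 2 * (m.re * z.re + m.im * z.im) :=
      nonneg_of_mul_nonneg_right (by linarith) hd0
    have e2 : cross u v * cross (v - u) (z - u) =
        cross u v ^ 2 * (1 - 2 * (m.re * z.re + m.im * z.im)) := by
      simp only [hm]
      field_simp
      simp only [cross, Complex.sub_re, Complex.sub_im]
      ring
    rw [e2]
    positivity
  · rw [← hu]
    simp only [hm]
    field_simp
    simp only [cross, Complex.sub_re, Complex.sub_im]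
    ring
  · rw [← hv]
    simp only [hm]
    field_simp
    simp only [cross, Complex.sub_re, Complex.sub_im]
    ring

/-! ### Poincaré disc, hyperboloid and Klein models. -/

/-- The disc automorphism which sends `a` to the origin. -/
noncomputable def moebius (a z : ℂ) : ℂ := (z - a) / (1 - starRingEnd ℂ a * z)

/-- The change of coordinates from the Poincaré disc model to the Klein model. -/
noncomputable def klein (z : ℂ) : ℂ := ((2 / (1 + ‖z‖ ^ 2) : ℝ) : ℂ) * z

/-- The time coordinate of a point of the hyperboloid model. -/
noncomputable def hypTime (z : ℂ) : ℝ := (1 + ‖z‖ ^ 2) / (1 - ‖z‖ ^ 2)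

/-- The space coordinates of a point of the hyperboloid model. -/
noncomputable def hypSpace (z : ℂ) : ℂ := ((2 / (1 - ‖z‖ ^ 2) : ℝ) : ℂ) * z

section Disc

open Complex

lemma one_sub_normSq_pos (z : UnitDisc) : 0 < 1 - normSq (z : ℂ) :=
  sub_pos.2 z.normSq_lt_one

lemma sinh_hypDist_div_two (z w : UnitDisc) :
    Real.sinh (hypDist z w / 2) = ‖(z : ℂ) - w‖ / Real.sqrt ((1 - ‖(z : ℂ)‖ ^ 2) * (1 - ‖(w : ℂ)‖ ^ 2)) := by
  rw [hypDist, mul_div_cancel_left₀ _ two_ne_zero, Real.sinh_arsinh]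

lemma sinh_hypDist_div_two_sq (z w : UnitDisc) :
    Real.sinh (hypDist z w / 2) ^ 2 =
      normSq ((z : ℂ) - w) / ((1 - normSq (z : ℂ)) * (1 - normSq (w : ℂ))) := by
  have h1 := one_sub_normSq_pos z
  have h2 := one_sub_normSq_pos w
  rw [sinh_hypDist_div_two, div_pow]
  simp only [Complex.sq_norm]
  rw [Real.sq_sqrt (by positivity)]

lemma hypDist_nonneg (z w : UnitDisc) : 0 ≤ hypDist z w :=
  mul_nonneg zero_le_two (Real.arsinh_nonneg_iff.2 (by positivity))

lemma hypDist_comm (z w : UnitDisc) : hypDist z w = hypDist w z := by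
  rw [hypDist, hypDist, norm_sub_rev, mul_comm (1 - ‖(z : ℂ)‖ ^ 2)]

lemma eq_of_hypDist_eq_zero {z w : UnitDisc} (h : hypDist z w = 0) : z = w := by
  have e := sinh_hypDist_div_two_sq z w
  have h1 := one_sub_normSq_pos z
  have h2 := one_sub_normSq_pos w
  rw [h] at e
  simp only [zero_div, Real.sinh_zero, ne_eq, OfNat.ofNat_ne_zero, not_false_eq_true, zero_pow] at e
  have := (div_eq_zero_iff.1 e.symm).resolve_right (by positivity)
  exact UnitDisc.coe_injective (sub_eq_zero.1 (normSq_eq_zero.1 this))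

lemma cosh_hypDist (z w : UnitDisc) :
    Real.cosh (hypDist z w) = hypTime z * hypTime w -
      ((hypSpace z).re * (hypSpace w).re + (hypSpace z).im * (hypSpace w).im) := by
  have e : Real.cosh (hypDist z w) = 1 + 2 * Real.sinh (hypDist z w / 2) ^ 2 := by
    have := Real.cosh_two_mul (hypDist z w / 2)
    rw [mul_div_cancel₀ _ two_ne_zero, Real.cosh_sq] at this
    rw [this]; ring
  have h1 := (one_sub_normSq_pos z).ne'
  have h2 := (one_sub_normSq_pos w).ne'
  rw [e, sinh_hypDist_div_two_sq]
  simp only [hypTime, hypSpace, Complex.sq_norm, re_ofReal_mul, im_ofReal_mul]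
  field_simp
  simp only [normSq_apply, sub_re, sub_im]
  ring

/-- A Lorentz-null vector which is orthogonal to a time-like vector vanishes. -/
lemma eq_zero_of_null_of_orthogonal {t x y T X Y : ℝ} (hT : X ^ 2 + Y ^ 2 < T ^ 2)
    (h : t ^ 2 = x ^ 2 + y ^ 2) (h' : t * T = x * X + y * Y) : t = 0 ∧ x = 0 ∧ y = 0 := by
  -- Lagrange's identity turns the two hypotheses into a vanishing sum of nonnegative terms.
  have e : (x ^ 2 + y ^ 2) * (T ^ 2 - (X ^ 2 + Y ^ 2)) + (x * Y - y * X) ^ 2 = 0 := by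
    have : (t * T) ^ 2 = (x * X + y * Y) ^ 2 := by rw [h']
    rw [mul_pow, h] at this
    linear_combination this
  have p : 0 ≤ (x ^ 2 + y ^ 2) * (T ^ 2 - (X ^ 2 + Y ^ 2)) :=
    mul_nonneg (by positivity) (by linarith)
  have z : (x ^ 2 + y ^ 2) * (T ^ 2 - (X ^ 2 + Y ^ 2)) = 0 := by nlinarith [sq_nonneg (x * Y - y * X)]
  have z2 := (mul_eq_zero.1 z).resolve_right (by linarith)
  have hx : x = 0 := by nlinarith [sq_nonneg x, sq_nonneg y]
  have hy : y = 0 := by nlinarith [sq_nonneg x, sq_nonneg y]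
  refine ⟨?_, hx, hy⟩
  rw [z2] at h
  exact pow_eq_zero_iff two_ne_zero |>.1 h

lemma hypTime_sq (z : UnitDisc) :
    (hypSpace z).re ^ 2 + (hypSpace z).im ^ 2 = hypTime z ^ 2 - 1 := by
  have h1 := (one_sub_normSq_pos z).ne'
  simp only [hypTime, hypSpace, Complex.sq_norm, re_ofReal_mul, im_ofReal_mul]
  field_simp
  simp only [normSq_apply]
  ring

/-- The points of a geodesic segment are nonnegative combinations of the end points in the
hyperboloid model. -/
lemma sinh_smul_of_mem_hypSegment {z x w : UnitDisc} (h : x ∈ hypSegment z w) :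
    Real.sinh (hypDist z w) * hypTime x =
      Real.sinh (hypDist x w) * hypTime z + Real.sinh (hypDist z x) * hypTime w ∧
    (Real.sinh (hypDist z w) : ℂ) * hypSpace x =
      Real.sinh (hypDist x w) * hypSpace z + Real.sinh (hypDist z x) * hypSpace w := by
  have hd : hypDist z w = hypDist z x + hypDist x w := Eq.symm h
  have c1 := cosh_hypDist z x
  have c2 := cosh_hypDist x w
  have c3 := cosh_hypDist z w
  have tz := hypTime_sq z
  have tx := hypTime_sq x
  have tw := hypTime_sq w
  have s1 := Real.cosh_sq (hypDist z x)
  have s2 := Real.cosh_sq (hypDist x w)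
  have s3 := Real.sinh_add (hypDist z x) (hypDist x w)
  have s4 := Real.cosh_add (hypDist z x) (hypDist x w)
  rw [← hd] at s3 s4
  generalize Real.sinh (hypDist z x) = a1 at *
  generalize Real.cosh (hypDist z x) = b1 at *
  generalize Real.sinh (hypDist x w) = a2 at *
  generalize Real.cosh (hypDist x w) = b2 at *
  generalize Real.sinh (hypDist z w) = a at *
  generalize Real.cosh (hypDist z w) = b at *
  -- The defect of the claimed linear relation is Lorentz-null and orthogonal to `z`, by the
  -- addition formulas for `d(z,w) = d(z,x) + d(x,w)`.
  have main := eq_zero_of_null_of_orthogonal (t := a * hypTime x - a2 * hypTime z - a1 * hypTime w)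
    (x := a * (hypSpace x).re - a2 * (hypSpace z).re - a1 * (hypSpace w).re)
    (y := a * (hypSpace x).im - a2 * (hypSpace z).im - a1 * (hypSpace w).im)
    (T := hypTime z) (X := (hypSpace z).re) (Y := (hypSpace z).im) (by linarith) ?_ ?_
  · obtain ⟨m1, m2, m3⟩ := main
    refine ⟨by linarith, Complex.ext ?_ ?_⟩
    · simp only [add_re, re_ofReal_mul]; linarith
    · simp only [add_im, im_ofReal_mul]; linarith
  · have e : (a * hypTime x - a2 * hypTime z - a1 * hypTime w) ^ 2 -
        ((a * (hypSpace x).re - a2 * (hypSpace z).re - a1 * (hypSpace w).re) ^ 2 +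
        (a * (hypSpace x).im - a2 * (hypSpace z).im - a1 * (hypSpace w).im) ^ 2) =
        a ^ 2 + a2 ^ 2 + a1 ^ 2 - 2 * a * a2 * b1 - 2 * a * a1 * b2 + 2 * a1 * a2 * b := by
      rw [c1, c2, c3]
      linear_combination (-a ^ 2) * tx - a2 ^ 2 * tz - a1 ^ 2 * tw
    have e2 : a ^ 2 + a2 ^ 2 + a1 ^ 2 - 2 * a * a2 * b1 - 2 * a * a1 * b2 + 2 * a1 * a2 * b = 0 := by
      rw [s3, s4]
      linear_combination (-a2 ^ 2) * s1 - a1 ^ 2 * s2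
    linarith
  · have e : (a * hypTime x - a2 * hypTime z - a1 * hypTime w) * hypTime z -
        ((a * (hypSpace x).re - a2 * (hypSpace z).re - a1 * (hypSpace w).re) * (hypSpace z).re +
        (a * (hypSpace x).im - a2 * (hypSpace z).im - a1 * (hypSpace w).im) * (hypSpace z).im) =
        a * b1 - a2 - a1 * b := by
      rw [c1, c3]
      linear_combination a2 * tz
    have e2 : a * b1 - a2 - a1 * b = 0 := by
      rw [s3, s4]
      linear_combination a2 * s1
    linarith

lemma one_sub_conj_mul_ne_zero (a z : UnitDisc) : 1 - starRingEnd ℂ (a : ℂ) * z ≠ 0 := by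
  intro h
  have h1 : ‖starRingEnd ℂ (a : ℂ) * z‖ = 1 := by
    rw [← sub_eq_zero.1 h, norm_one]
  rw [norm_mul, RCLike.norm_conj] at h1
  have := mul_lt_one_of_nonneg_of_lt_one_left (norm_nonneg _) a.norm_lt_one z.norm_lt_one.le
  linarith

/-- The boost of the hyperboloid model which corresponds to `moebius a`, read in the Klein model. -/
lemma klein_moebius (a z : UnitDisc) :
    0 < (1 + normSq (a : ℂ)) * hypTime z - 2 * ((a : ℂ).re * (hypSpace z).re + (a : ℂ).im * (hypSpace z).im) ∧
    klein (moebius a z) *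
      (((1 + normSq (a : ℂ)) * hypTime z - 2 * ((a : ℂ).re * (hypSpace z).re + (a : ℂ).im * (hypSpace z).im) : ℝ) : ℂ) =
      hypSpace z + (a : ℂ) ^ 2 * starRingEnd ℂ (hypSpace z) - 2 * a * hypTime z := by
  have h1 := one_sub_normSq_pos z
  have ha := one_sub_normSq_pos a
  have h2 : 0 < normSq (1 - starRingEnd ℂ (a : ℂ) * z) := normSq_pos.2 (one_sub_conj_mul_ne_zero a z)
  have e1 : (1 + normSq (a : ℂ)) * hypTime z - 2 * ((a : ℂ).re * (hypSpace z).re + (a : ℂ).im * (hypSpace z).im)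
      = (normSq (1 - starRingEnd ℂ (a : ℂ) * z) + normSq ((z : ℂ) - a)) / (1 - normSq (z : ℂ)) := by
    simp only [hypTime, hypSpace, Complex.sq_norm, re_ofReal_mul, im_ofReal_mul]
    field_simp
    simp [normSq_apply]
    ring
  refine ⟨?_, ?_⟩
  · rw [e1]
    have := normSq_nonneg ((z : ℂ) - a)
    positivity
  · rw [e1]
    have hs : 0 < normSq (1 - starRingEnd ℂ (a : ℂ) * z) + normSq ((z : ℂ) - a) := by
      have := normSq_nonneg ((z : ℂ) - a)
      positivity
    have e2 : klein (moebius a z) = ((2 / (normSq (1 - starRingEnd ℂ (a : ℂ) * z) + normSq ((z : ℂ) - a)) : ℝ) : ℂ) *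
        ((z - a) * starRingEnd ℂ (1 - starRingEnd ℂ (a : ℂ) * z)) := by
      rw [klein, moebius, Complex.sq_norm, normSq_div]
      have aux : ∀ N D : ℝ, 0 < N → 2 / (1 + D / N) = 2 / (N + D) * N := fun N D hN => by
        field_simp
      rw [aux _ _ h2, ofReal_mul, mul_assoc, normSq_eq_conj_mul_self]
      have := one_sub_conj_mul_ne_zero a z
      field_simp
    rw [e2]
    have e3 : hypSpace z + (a : ℂ) ^ 2 * starRingEnd ℂ (hypSpace z) - 2 * a * hypTime z =
      ((2 / (1 - normSq (z : ℂ)) : ℝ) : ℂ) * ((z - a) * starRingEnd ℂ (1 - starRingEnd ℂ (a : ℂ) * z)) := by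
      have h1' : (1 : ℂ) - normSq (z : ℂ) ≠ 0 := by
        rw [← ofReal_one, ← ofReal_sub]; exact ofReal_ne_zero.2 h1.ne'
      simp only [hypTime, hypSpace, Complex.sq_norm, map_mul, conj_ofReal, map_sub, map_one, conj_conj]
      push_cast
      field_simp
      rw [normSq_eq_conj_mul_self]
      ring
    rw [e3, mul_right_comm, ← ofReal_mul]
    congr 2
    field_simp

/-- Metric betweenness is a nonnegative linear relation on the hyperboloid. The boost is linear and
the Klein model divides by its positive time coordinate, so the relation becomes a convex
combination. -/
lemma klein_moebius_mem_segment {z x w : UnitDisc} (a : UnitDisc) (h : x ∈ hypSegment z w) :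
    klein (moebius a x) ∈ segment ℝ (klein (moebius a z)) (klein (moebius a w)) := by
  have hd : hypDist z w = hypDist z x + hypDist x w := Eq.symm h
  have n1 := hypDist_nonneg z x
  have n2 := hypDist_nonneg x w
  rcases (hypDist_nonneg z w).eq_or_lt with h0 | h0
  · have z1 : hypDist z x = 0 := by linarith
    rw [eq_of_hypDist_eq_zero z1]
    exact left_mem_segment _ _ _
  obtain ⟨e1, e2⟩ := sinh_smul_of_mem_hypSegment h
  obtain ⟨pz, kz⟩ := klein_moebius a z
  obtain ⟨px, kx⟩ := klein_moebius a x
  obtain ⟨pw, kw⟩ := klein_moebius a w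
  set D : UnitDisc → ℝ := fun z => (1 + normSq (a : ℂ)) * hypTime z -
    2 * ((a : ℂ).re * (hypSpace z).re + (a : ℂ).im * (hypSpace z).im) with hD
  have s0 : 0 < Real.sinh (hypDist z w) := Real.sinh_pos_iff.2 h0
  have s1 : 0 ≤ Real.sinh (hypDist z x) := Real.sinh_nonneg_iff.2 n1
  have s2 : 0 ≤ Real.sinh (hypDist x w) := Real.sinh_nonneg_iff.2 n2
  have e3 : Real.sinh (hypDist z w) * D x =
      Real.sinh (hypDist x w) * D z + Real.sinh (hypDist z x) * D w := by
    have r := congrArg re e2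
    have i := congrArg im e2
    simp only [add_re, add_im, re_ofReal_mul, im_ofReal_mul] at r i
    simp only [hD]
    linear_combination (1 + normSq (a : ℂ)) * e1 - 2 * (a : ℂ).re * r - 2 * (a : ℂ).im * i
  have e4 : (Real.sinh (hypDist z w) : ℂ) * (klein (moebius a x) * D x) =
      Real.sinh (hypDist x w) * (klein (moebius a z) * D z) +
      Real.sinh (hypDist z x) * (klein (moebius a w) * D w) := by
    simp only [hD]
    rw [kx, kz, kw]
    have c := congrArg (starRingEnd ℂ) e2
    simp only [map_add, map_mul, conj_ofReal] at c
    have e1' := congrArg (fun r : ℝ => (r : ℂ)) e1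
    push_cast at e1'
    push_cast at c e2 ⊢
    linear_combination e2 + (a : ℂ) ^ 2 * c - 2 * (a : ℂ) * e1'
  have q : 0 < Real.sinh (hypDist z w) * D x := mul_pos s0 px
  refine ⟨Real.sinh (hypDist x w) * D z / (Real.sinh (hypDist z w) * D x),
    Real.sinh (hypDist z x) * D w / (Real.sinh (hypDist z w) * D x),
    div_nonneg (mul_nonneg s2 pz.le) q.le, div_nonneg (mul_nonneg s1 pw.le) q.le, ?_, ?_⟩
  · rw [← add_div, ← e3, div_self q.ne']
  · have q' : (Real.sinh (hypDist z w) : ℂ) * D x ≠ 0 := by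
      rw [← ofReal_mul]; exact ofReal_ne_zero.2 q.ne'
    simp only [real_smul, ofReal_div, ofReal_mul]
    rw [div_mul_eq_mul_div, div_mul_eq_mul_div, ← add_div, div_eq_iff q']
    linear_combination -e4

lemma klein_injective : Function.Injective fun z : UnitDisc => klein z := by
  -- Explicit recovery of `z`, from `√(1 - |klein z|²) = (1 - |z|²) / (1 + |z|²)`.
  have inv : ∀ z : UnitDisc, ((1 + Real.sqrt (1 - normSq (klein z)) : ℝ) : ℂ) * z = klein z := by
    intro z
    have h1 := one_sub_normSq_pos z
    have h2 := normSq_nonneg (z : ℂ)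
    have e : 1 - normSq (klein z) = ((1 - normSq (z : ℂ)) / (1 + normSq (z : ℂ))) ^ 2 := by
      rw [klein, normSq_mul, normSq_ofReal, Complex.sq_norm]
      field_simp
      ring
    rw [e, Real.sqrt_sq (by positivity), klein, Complex.sq_norm]
    congr 2
    field_simp
    ring
  intro z w h
  have e1 := inv z
  have e2 := inv w
  simp only at h
  rw [h] at e1
  replace e1 := e1.trans e2.symm
  have : ((1 + Real.sqrt (1 - normSq (klein w)) : ℝ) : ℂ) ≠ 0 := by
    rw [ofReal_ne_zero]
    positivity
  exact UnitDisc.coe_injective (mul_left_cancel₀ this e1)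

lemma normSq_one_sub_conj_mul (a z : ℂ) : normSq (1 - starRingEnd ℂ a * z) - normSq (z - a) =
    (1 - normSq a) * (1 - normSq z) := by
  simp [normSq_apply]
  ring

lemma norm_moebius_lt_one (a z : UnitDisc) : ‖moebius a z‖ < 1 := by
  have h1 := one_sub_normSq_pos a
  have h2 := one_sub_normSq_pos z
  have h3 : 0 < normSq (1 - starRingEnd ℂ (a : ℂ) * z) := normSq_pos.2 (one_sub_conj_mul_ne_zero a z)
  have e := normSq_one_sub_conj_mul a z
  have p := mul_pos h1 h2
  rw [← sq_lt_one_iff₀ (norm_nonneg _), Complex.sq_norm, moebius, normSq_div, div_lt_one h3]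
  linarith

lemma moebius_injective (a : UnitDisc) : Function.Injective fun z : UnitDisc => moebius a z := by
  intro z w h
  have h1 := one_sub_conj_mul_ne_zero a z
  have h2 := one_sub_conj_mul_ne_zero a w
  have h3 := one_sub_conj_mul_ne_zero a a
  simp only [moebius] at h
  rw [div_eq_div_iff h1 h2] at h
  have : ((z : ℂ) - w) * (1 - starRingEnd ℂ (a : ℂ) * a) = 0 := by linear_combination h
  exact UnitDisc.coe_injective (sub_eq_zero.1 ((mul_eq_zero.1 this).resolve_right h3))

lemma klein_moebius_injective (a : UnitDisc) :
    Function.Injective fun z : UnitDisc => klein (moebius a z) := by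
  intro z w h
  have := @klein_injective (UnitDisc.mk _ (norm_moebius_lt_one a z))
    (UnitDisc.mk _ (norm_moebius_lt_one a w)) (by simpa using h)
  exact moebius_injective a (by simpa [UnitDisc.mk_inj] using this)

lemma continuous_klein_moebius (a : UnitDisc) :
    Continuous fun z : UnitDisc => klein (moebius a z) := by
  have h1 : Continuous fun z : UnitDisc => moebius a z := by
    unfold moebius
    have := UnitDisc.continuous_coe
    exact Continuous.div (by fun_prop) (by fun_prop) fun z => one_sub_conj_mul_ne_zero a z
  have h2 : Continuous klein := by
    unfold klein
    refine Continuous.mul (continuous_ofReal.comp ?_) continuous_id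
    exact Continuous.div (by fun_prop) (by fun_prop) fun z => by positivity
  exact h2.comp h1

/-! ### The inverted polygon and its lengths. -/

/-- The image of `z` under the disc automorphism sending `a` to the origin, followed by the inversion
in the unit circle. -/
noncomputable def farPoint (a z : ℂ) : ℂ := ((1 - normSq a : ℝ) : ℂ) * invCircle (z - a) - a

lemma farPoint_eq {a z : ℂ} (h : z ≠ a) :
    farPoint a z = (1 - a * starRingEnd ℂ z) / starRingEnd ℂ (z - a) := by
  have : starRingEnd ℂ (z - a) ≠ 0 := by rwa [Ne, map_eq_zero, sub_eq_zero]
  unfold farPoint invCircle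
  rw [mul_one_div, div_sub' this, ofReal_sub, normSq_eq_conj_mul_self]
  congr 1
  simp
  ring

/-- Inversion and the passage to the Klein model both preserve rays from the origin, so orientations
and angles at the centre can be read off in the Klein model. -/
lemma farPoint_eq_mul_klein {a z : UnitDisc} (h : z ≠ a) :
    ∃ c : ℝ, 0 < c ∧ farPoint a z = c * klein (moebius a z) := by
  have hza : (z : ℂ) - a ≠ 0 := sub_ne_zero.2 fun e => h (UnitDisc.coe_injective e)
  have h1 := one_sub_conj_mul_ne_zero a z
  have hm : 0 < normSq (moebius a z) := normSq_pos.2 (div_ne_zero hza h1)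
  refine ⟨(1 + normSq (moebius a z)) / (2 * normSq (moebius a z)), by positivity, ?_⟩
  rw [klein, ← mul_assoc, ← ofReal_mul, Complex.sq_norm]
  have e : (1 + normSq (moebius a z)) / (2 * normSq (moebius a z)) * (2 / (1 + normSq (moebius a z))) =
      (normSq (moebius a z))⁻¹ := by
    field_simp
  have hc : starRingEnd ℂ ((z : ℂ) - a) ≠ 0 := by rwa [Ne, map_eq_zero]
  have hmz : moebius a z ≠ 0 := div_ne_zero hza h1
  have h2 : starRingEnd ℂ (1 - starRingEnd ℂ (a : ℂ) * z) ≠ 0 := by rwa [Ne, map_eq_zero]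
  rw [e, farPoint_eq (sub_ne_zero.1 hza), ofReal_inv, normSq_eq_conj_mul_self, mul_inv,
    inv_mul_cancel_right₀ hmz, moebius, map_div₀, inv_div]
  congr 1
  simp

lemma normSq_farPoint {a z : UnitDisc} (h : z ≠ a) :
    normSq (farPoint a z) = 1 + 1 / Real.sinh (hypDist a z / 2) ^ 2 := by
  have hza : (z : ℂ) - a ≠ 0 := sub_ne_zero.2 fun e => h (UnitDisc.coe_injective e)
  have hp : 0 < normSq ((z : ℂ) - a) := normSq_pos.2 hza
  have h1 := one_sub_normSq_pos a
  have h2 := one_sub_normSq_pos z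
  have e := normSq_one_sub_conj_mul a z
  rw [hypDist_comm, sinh_hypDist_div_two_sq, farPoint_eq (sub_ne_zero.1 hza), normSq_div, normSq_conj]
  have e2 : normSq (1 - (a : ℂ) * starRingEnd ℂ (z : ℂ)) = normSq (1 - starRingEnd ℂ (a : ℂ) * z) := by
    rw [← normSq_conj]; simp
  rw [e2]
  field_simp
  linarith

/-- In this quotient the conformal factors at `z` and `w` cancel and only the one at `a` survives;
this is the reason for inverting. -/
lemma normSq_farPoint_sub {a z w : UnitDisc} (hz : z ≠ a) (hw : w ≠ a) :
    normSq (farPoint a z - farPoint a w) = Real.sinh (hypDist z w / 2) ^ 2 /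
      (Real.sinh (hypDist a z / 2) ^ 2 * Real.sinh (hypDist a w / 2) ^ 2) := by
  have hza : (z : ℂ) - a ≠ 0 := sub_ne_zero.2 fun e => hz (UnitDisc.coe_injective e)
  have hwa : (w : ℂ) - a ≠ 0 := sub_ne_zero.2 fun e => hw (UnitDisc.coe_injective e)
  have hp : 0 < normSq ((z : ℂ) - a) := normSq_pos.2 hza
  have hq : 0 < normSq ((w : ℂ) - a) := normSq_pos.2 hwa
  have h1 := one_sub_normSq_pos a
  have h2 := one_sub_normSq_pos z
  have h3 := one_sub_normSq_pos w
  have hzc : starRingEnd ℂ ((z : ℂ) - a) ≠ 0 := by rwa [Ne, map_eq_zero]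
  have hwc : starRingEnd ℂ ((w : ℂ) - a) ≠ 0 := by rwa [Ne, map_eq_zero]
  have e : farPoint a z - farPoint a w = ((1 - normSq (a : ℂ) : ℝ) : ℂ) *
      (starRingEnd ℂ ((w : ℂ) - z) / (starRingEnd ℂ ((z : ℂ) - a) * starRingEnd ℂ ((w : ℂ) - a))) := by
    unfold farPoint invCircle
    field_simp
    simp only [map_sub]
    ring
  rw [e, hypDist_comm a z, hypDist_comm a w]
  simp only [sinh_hypDist_div_two_sq]
  rw [normSq_mul, normSq_div, normSq_mul, normSq_conj, normSq_conj, normSq_conj, normSq_ofReal,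
    ← neg_sub (z : ℂ) w, normSq_neg]
  field_simp

end Disc

/-! ### Winding numbers of paths along segments. -/

section Winding

open Complex

lemma im_div_eq_cross (u v : ℂ) : (u / v).im = cross v u / normSq v := by
  rw [div_im, cross]
  ring

lemma cross_sub_sub_eq_zero {A B x : ℂ} (h : x ∈ segment ℝ A B) : cross (A - x) (B - x) = 0 := by
  obtain ⟨a, b, -, -, hab, rfl⟩ := h
  have : b = 1 - a := by linarith
  subst this
  simp [cross]
  ring

lemma div_mem_slitPlane {A B p x : ℂ} (hp : p ∉ segment ℝ A B) (hx : x ∈ segment ℝ A B) :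
    (x - p) / (A - p) ∈ slitPlane := by
  have hA : A - p ≠ 0 := sub_ne_zero.2 fun h => hp (h ▸ left_mem_segment ℝ A B)
  by_contra hs
  rw [mem_slitPlane_iff_not_le_zero, not_not, Complex.le_def] at hs
  set c := ((x - p) / (A - p)).re with hc
  have hc0 : c ≤ 0 := hs.1
  have e : (x - p) / (A - p) = (c : ℂ) := Complex.ext (by simp [hc]) (by simpa using hs.2)
  rw [div_eq_iff hA] at e
  refine hp ((convex_segment A B).segment_subset hx (left_mem_segment ℝ A B) ?_)
  have h1 : 0 < 1 - c := by linarith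
  refine ⟨1 / (1 - c), -c / (1 - c), by positivity, div_nonneg (by linarith) h1.le, ?_, ?_⟩
  · field_simp
    ring
  · have h1' : (1 : ℂ) - c ≠ 0 := by exact_mod_cast h1.ne'
    simp only [real_smul]
    push_cast
    field_simp
    linear_combination e

/-- The imaginary part starts at `0` and cannot reach `±π`, where the exponential would lie on the
negative axis; so the lift stays in the principal branch. -/
lemma log_exp_of_forall_mem_slitPlane {h : ℝ → ℂ} (hc : Continuous h) (h0 : h 0 = 0)
    (hs : ∀ t ∈ Set.Icc (0 : ℝ) 1, exp (h t) ∈ slitPlane) : log (exp (h 1)) = h 1 := by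
  have hci : ContinuousOn (fun t => (h t).im) (Set.Icc 0 1) := (continuous_im.comp hc).continuousOn
  have key : ∀ t ∈ Set.Icc (0 : ℝ) 1, |(h t).im| ≠ Real.pi := by
    intro t ht he
    refine mem_slitPlane_iff_not_le_zero.1 (hs t ht) ?_
    have hsin : Real.sin (h t).im = 0 := by
      rcases (abs_eq Real.pi_pos.le).1 he with e | e <;> simp [e]
    have hcos : Real.cos (h t).im = -1 := by
      rw [← Real.cos_abs, he, Real.cos_pi]
    rw [Complex.le_def, exp_re, exp_im, hsin, hcos]
    have := Real.exp_pos (h t).re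
    simp [this.le]
  have hlt : |(h 1).im| < Real.pi := by
    by_contra! hge
    have : Real.pi ∈ Set.Icc |(h 0).im| |(h 1).im| := ⟨by simp [h0, Real.pi_pos.le], hge⟩
    obtain ⟨t, ht, he⟩ := intermediate_value_Icc zero_le_one hci.abs this
    exact key t ht he
  rw [abs_lt] at hlt
  exact log_exp hlt.1 hlt.2.le

/-- The variation of a logarithm of `γ - p` along a path `γ` which stays in the segment from `A` to
`B`. -/
lemma sub_eq_log_of_segment {A B p : ℂ} {γ L : ℝ → ℂ} (hp : p ∉ segment ℝ A B)
    (hγ : ∀ t ∈ Set.Icc (0 : ℝ) 1, γ t ∈ segment ℝ A B) (h0 : γ 0 = A) (h1 : γ 1 = B)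
    (hL : Continuous L) (hexp : ∀ t, exp (L t) = γ t - p) :
    L 1 - L 0 = log ((B - p) / (A - p)) := by
  have e : ∀ t, exp (L t - L 0) = (γ t - p) / (A - p) := fun t => by
    rw [exp_sub, hexp, hexp, h0]
  have := log_exp_of_forall_mem_slitPlane (h := fun t => L t - L 0) (by fun_prop) (by simp)
    fun t ht => by rw [e]; exact div_mem_slitPlane hp (hγ t ht)
  rw [← this, e, h1]

lemma isSimplyConnected_univ_plane : IsSimplyConnected (Set.univ : Set (ℝ × ℝ)) := by
  have := (convex_univ (𝕜 := ℝ) (E := ℝ × ℝ)).contractibleSpace Set.univ_nonempty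
  exact SimplyConnectedSpace.ofContractible _

/-- A continuous map of a square, collapsed to a triangle along one side, which maps the sides of the
triangle into the sides of the triangle `A B C`, covers the interior of `A B C`. -/
lemma exists_eq_of_cross {A B C p : ℂ} {F : ℝ × ℝ → ℂ} (hF : Continuous F)
    (hAB : ∀ s ∈ Set.Icc (0 : ℝ) 1, F (s, 0) ∈ segment ℝ A B)
    (hBC : ∀ t ∈ Set.Icc (0 : ℝ) 1, F (1, t) ∈ segment ℝ B C)
    (hAC : ∀ s ∈ Set.Icc (0 : ℝ) 1, F (s, 1) ∈ segment ℝ A C)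
    (hA : ∀ t, F (0, t) = A) (hB : F (1, 0) = B) (hC : F (1, 1) = C)
    (h : (0 < cross (A - p) (B - p) ∧ 0 < cross (B - p) (C - p) ∧ 0 < cross (C - p) (A - p)) ∨
      (cross (A - p) (B - p) < 0 ∧ cross (B - p) (C - p) < 0 ∧ cross (C - p) (A - p) < 0)) :
    ∃ q, F q = p := by
  by_contra! hne
  -- If `p` is missed, `F - p` has a global logarithm, so its variation around the square is zero;
  -- but the three sides contribute arguments of one common strict sign.
  obtain ⟨L, hLc, hL⟩ := exists_continuousOn_eqOn_exp_comp isSimplyConnected_univ_plane isOpen_univ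
    (g := fun q => F q - p) (by fun_prop) (by
      rintro ⟨q, -, hq⟩
      exact hne q (sub_eq_zero.1 hq))
  rw [continuousOn_univ] at hLc
  replace hL : ∀ q, exp (L q) = F q - p := fun q => hL (Set.mem_univ q)
  have n1 : p ∉ segment ℝ A B := fun hp => by
    have := cross_sub_sub_eq_zero hp
    rcases h with h | h <;> linarith [h.1]
  have n2 : p ∉ segment ℝ B C := fun hp => by
    have := cross_sub_sub_eq_zero hp
    rcases h with h | h <;> linarith [h.2.1]
  have n3 : p ∉ segment ℝ C A := fun hp => by
    have := cross_sub_sub_eq_zero hp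
    rcases h with h | h <;> linarith [h.2.2]
  have hpA : A - p ≠ 0 := sub_ne_zero.2 fun h => n1 (h ▸ left_mem_segment ℝ A B)
  have l1 := sub_eq_log_of_segment (L := fun s => L (s, 0)) n1 hAB (hA 0) hB (by fun_prop)
    (fun _ => hL _)
  have l2 := sub_eq_log_of_segment (L := fun t => L (1, t)) n2 hBC hB hC (by fun_prop) (fun _ => hL _)
  have l3 := sub_eq_log_of_segment (γ := fun s => F (1 - s, 1)) (L := fun s => L (1 - s, 1)) n3
    (fun s hs => segment_symm ℝ A C ▸ hAC (1 - s) ⟨by linarith [hs.2], by linarith [hs.1]⟩)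
    (by simpa using hC) (by simpa using hA 1) (by fun_prop) (fun _ => hL _)
  have l4 := sub_eq_log_of_segment (A := A) (B := A) (L := fun t => L (0, t)) (p := p)
    (by simpa using Ne.symm (sub_ne_zero.1 hpA)) (fun t _ => by simp [hA t]) (hA 0) (hA 1)
    (by fun_prop) (fun _ => hL _)
  rw [div_self hpA, log_one] at l4
  simp only [sub_zero, sub_self] at l3
  have sum : (log ((B - p) / (A - p))).im + (log ((C - p) / (B - p))).im +
      (log ((A - p) / (C - p))).im = 0 := by
    rw [← add_im, ← add_im, ← l1, ← l2, ← l3, ← zero_im]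
    congr 1
    linear_combination l4
  simp only [log_im] at sum
  have pos : ∀ {u v : ℂ}, 0 < cross v u → 0 < (u / v).arg := by
    intro u v huv
    have hv : 0 < normSq v := normSq_pos.2 (by rintro rfl; simp [cross] at huv)
    have him : 0 < (u / v).im := by rw [im_div_eq_cross]; positivity
    refine lt_of_le_of_ne (arg_nonneg_iff.2 him.le) fun h0 => ?_
    exact him.ne' (arg_eq_zero_iff.1 h0.symm).2
  have neg : ∀ {u v : ℂ}, cross v u < 0 → (u / v).arg < 0 := by
    intro u v huv
    have hv : 0 < normSq v := normSq_pos.2 (by rintro rfl; simp [cross] at huv)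
    rw [arg_neg_iff, im_div_eq_cross]
    exact div_neg_of_neg_of_pos huv hv
  rcases h with ⟨h1, h2, h3⟩ | ⟨h1, h2, h3⟩
  · linarith [pos h1, pos h2, pos h3]
  · linarith [neg h1, neg h2, neg h3]

/-- A path in a segment which joins its end points covers the segment. -/
lemma exists_eq_of_mem_segment {A B y : ℂ} {γ : ℝ → ℂ} (hγ : ContinuousOn γ (Set.Icc 0 1))
    (hmem : ∀ t ∈ Set.Icc (0 : ℝ) 1, γ t ∈ segment ℝ A B) (h0 : γ 0 = A) (h1 : γ 1 = B)
    (hy : y ∈ segment ℝ A B) : ∃ t ∈ Set.Icc (0 : ℝ) 1, γ t = y := by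
  rcases eq_or_ne A B with rfl | hAB
  · rw [segment_same] at hy
    exact ⟨0, by simp, h0.trans hy.symm⟩
  have hN : 0 < normSq (B - A) := normSq_pos.2 (sub_ne_zero.2 hAB.symm)
  have hc : ContinuousOn (fun t => ((γ t - A) / (B - A)).re) (Set.Icc 0 1) :=
    continuous_re.comp_continuousOn ((hγ.sub continuousOn_const).div_const _)
  have par : ∀ x ∈ segment ℝ A B, ∃ τ ∈ Set.Icc (0 : ℝ) 1, x - A = τ * (B - A) := by
    rintro x ⟨a, b, ha, hb, hab, rfl⟩
    refine ⟨b, ⟨hb, by linarith⟩, ?_⟩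
    have : a = 1 - b := by linarith
    subst this
    simp only [real_smul]
    push_cast
    ring
  have hBA : B - A ≠ 0 := sub_ne_zero.2 hAB.symm
  obtain ⟨τ, hτ, e⟩ := par y hy
  obtain ⟨t, ht, hτt⟩ := intermediate_value_Icc zero_le_one hc (show τ ∈ _ by
    simpa [h0, h1, div_self hBA] using hτ)
  obtain ⟨σ, -, e'⟩ := par (γ t) (hmem t ht)
  refine ⟨t, ht, ?_⟩
  simp only [e', mul_div_cancel_right₀ _ hBA, ofReal_re] at hτt
  rw [hτt, ← e] at e'
  exact sub_left_injective e'

end Winding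

/-! ### Disjoint sectors around the origin. -/

section Sectors

open Complex

/-- The open cone spanned by `a` and `b`. -/
def openCone (a b : ℂ) : Set ℂ := {p | ∃ x y : ℝ, 0 < x ∧ 0 < y ∧ p = x * a + y * b}

lemma conj_mem_openCone {a b p : ℂ} (h : starRingEnd ℂ p ∈ openCone (starRingEnd ℂ a) (starRingEnd ℂ b)) :
    p ∈ openCone a b := by
  obtain ⟨x, y, hx, hy, e⟩ := h
  refine ⟨x, y, hx, hy, ?_⟩
  have := congrArg (starRingEnd ℂ) e
  simpa using this

lemma exp_mem_openCone {a b : ℂ} {α β τ : ℝ} (ha : a ≠ 0) (hb : b ≠ 0)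
    (ea : a = ‖a‖ * exp (α * I)) (eb : b = ‖b‖ * exp (β * I)) (h1 : α < τ) (h2 : τ < β)
    (h3 : β < α + Real.pi) : exp (τ * I) ∈ openCone a b := by
  have ha0 := norm_pos_iff.2 ha
  have hb0 := norm_pos_iff.2 hb
  have s0 : 0 < Real.sin (β - α) := Real.sin_pos_of_pos_of_lt_pi (by linarith) (by linarith)
  have s1 : 0 < Real.sin (β - τ) := Real.sin_pos_of_pos_of_lt_pi (by linarith) (by linarith)
  have s2 : 0 < Real.sin (τ - α) := Real.sin_pos_of_pos_of_lt_pi (by linarith) (by linarith)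
  refine ⟨Real.sin (β - τ) / (Real.sin (β - α) * ‖a‖), Real.sin (τ - α) / (Real.sin (β - α) * ‖b‖),
    by positivity, by positivity, ?_⟩
  have key : (Real.sin (β - α) : ℂ) * exp (τ * I) =
      Real.sin (β - τ) * exp (α * I) + Real.sin (τ - α) * exp (β * I) := by
    apply Complex.ext
    · simp only [re_ofReal_mul, add_re, exp_ofReal_mul_I_re, Real.sin_sub]
      ring
    · simp only [im_ofReal_mul, add_im, exp_ofReal_mul_I_im, Real.sin_sub]
      ring
  have n1 : (‖a‖ : ℂ) ≠ 0 := ofReal_ne_zero.2 ha0.ne'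
  have n2 : (‖b‖ : ℂ) ≠ 0 := ofReal_ne_zero.2 hb0.ne'
  have n3 : (Real.sin (β - α) : ℂ) ≠ 0 := ofReal_ne_zero.2 s0.ne'
  generalize ‖a‖ = r at *
  generalize ‖b‖ = r' at *
  subst ea eb
  simp only [ofReal_div, ofReal_mul]
  generalize (Real.sin (β - α) : ℂ) = S at *
  generalize exp (τ * I) = u at *
  generalize exp (α * I) = v at *
  generalize exp (β * I) = w at *
  field_simp
  linear_combination key

lemma angle_of_cross_pos {a b : ℂ} (h : 0 < cross a b) :
    InnerProductGeometry.angle a b = (b / a).arg ∧ 0 < (b / a).arg ∧ (b / a).arg < Real.pi := by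
  have ha : a ≠ 0 := by rintro rfl; simp [cross] at h
  have hb : b ≠ 0 := by rintro rfl; simp [cross] at h
  have him : 0 < (b / a).im := by
    rw [im_div_eq_cross]
    exact div_pos h (normSq_pos.2 ha)
  have pos : 0 < (b / a).arg := lt_of_le_of_ne (arg_nonneg_iff.2 him.le)
    fun h0 => him.ne' (arg_eq_zero_iff.1 h0.symm).2
  refine ⟨?_, pos, lt_of_le_of_ne (arg_le_pi _) fun h0 => him.ne' (arg_eq_pi_iff.1 h0).2⟩
  rw [InnerProductGeometry.angle_comm, angle_eq_abs_arg hb ha, abs_of_pos pos]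

/-- If a cyclic sequence of positively oriented sectors has no overlaps, its total angle is `2π`. -/
lemma sum_angle_eq_two_pi {n : ℕ} (hn : 2 ≤ n) [NeZero n] {b : ZMod n → ℂ}
    (h : ∀ k, 0 < cross (b k) (b (k + 1)))
    (hd : ∀ k l, k ≠ l → Disjoint (openCone (b k) (b (k + 1))) (openCone (b l) (b (l + 1)))) :
    ∑ k, InnerProductGeometry.angle (b k) (b (k + 1)) = 2 * Real.pi := by
  have hb : ∀ k, b k ≠ 0 := fun k hk => by have := h k; simp [hk, cross] at this
  set θ : ZMod n → ℝ := fun k => (b (k + 1) / b k).arg with hθ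
  have θpos : ∀ k, 0 < θ k := fun k => (angle_of_cross_pos (h k)).2.1
  have θlt : ∀ k, θ k < Real.pi := fun k => (angle_of_cross_pos (h k)).2.2
  set A : ℕ → ℝ := fun m => (b 0).arg + ∑ j ∈ Finset.range m, θ j with hA
  have Asucc : ∀ m : ℕ, A (m + 1) = A m + θ m := fun m => by
    simp only [hA, Finset.sum_range_succ, add_assoc]
  have Amono : StrictMono A := strictMono_nat_of_lt_succ fun m => by
    rw [Asucc]; linarith [θpos m]
  have hbA : ∀ m : ℕ, b m = ‖b m‖ * exp (A m * I) := by
    intro m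
    induction m with
    | zero => simp [hA]
    | succ m ih =>
      have e := norm_mul_exp_arg_mul_I (b (m + 1) / b m)
      rw [norm_div, eq_div_iff (hb m), ofReal_div] at e
      have n1 : (‖b m‖ : ℂ) ≠ 0 := ofReal_ne_zero.2 (norm_pos_iff.2 (hb m)).ne'
      push_cast
      rw [Asucc, ofReal_add, add_mul, exp_add]
      calc b (m + 1) = ‖b (m + 1)‖ / ‖b m‖ * exp (θ m * I) * b m := e.symm
        _ = ‖b (m + 1)‖ / ‖b m‖ * exp (θ m * I) * (‖b m‖ * exp (A m * I)) := by rw [← ih]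
        _ = ‖b (m + 1)‖ * (exp (A m * I) * exp (θ m * I)) := by
          field_simp
  have hsum : A n - A 0 = ∑ k, θ k := by
    have e1 : A n - A 0 = ∑ j ∈ Finset.range n, θ j := by simp [hA]
    rw [e1]
    refine Finset.sum_bij' (fun j _ => (j : ZMod n)) (fun k _ => k.val) (by simp)
      (fun k _ => Finset.mem_range.2 (ZMod.val_lt k)) (fun j hj => ?_) (fun k _ => ?_) (by simp)
    · exact ZMod.val_cast_of_lt (Finset.mem_range.1 hj)
    · exact ZMod.natCast_zmod_val k
  -- The direction returns to that of `b 0` after `n` steps. If `N ≥ 2`, the first sector ending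
  -- beyond a full turn meets sector `0` just past its initial ray.
  obtain ⟨N, hN⟩ : ∃ N : ℤ, A n = A 0 + N * (2 * Real.pi) := by
    have e1 := hbA n
    have e0 := hbA 0
    simp only [ZMod.natCast_self, Nat.cast_zero] at e1 e0
    have n1 : (‖b 0‖ : ℂ) ≠ 0 := ofReal_ne_zero.2 (norm_pos_iff.2 (hb 0)).ne'
    have e2 := mul_left_cancel₀ n1 (e1.symm.trans e0)
    obtain ⟨N, hN⟩ := exp_eq_exp_iff_exists_int.1 e2
    refine ⟨N, ?_⟩
    have := congrArg im hN
    simpa using this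
  have hAn : A 0 < A n := Amono (by omega)
  have hpi := Real.pi_pos
  have hN0 : 0 < N := by
    have : (0 : ℝ) < N := by
      by_contra! hle
      nlinarith
    exact_mod_cast this
  have hN1 : N = 1 := by
    by_contra hne
    have h2 : (2 : ℝ) ≤ N := by exact_mod_cast (by omega : 2 ≤ N)
    have hlt : A 0 + 2 * Real.pi < A n := by nlinarith
    have hex : ∃ m, A 0 + 2 * Real.pi < A m := ⟨n, hlt⟩
    classical
    set m := Nat.find hex with hm
    have hm1 : A 0 + 2 * Real.pi < A m := Nat.find_spec hex
    have hmn : m ≤ n := Nat.find_min' hex hlt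
    obtain ⟨l, hl⟩ : ∃ l, m = l + 1 := Nat.exists_eq_succ_of_ne_zero (by
      intro h0; rw [h0] at hm1; linarith)
    have hl1 : A l ≤ A 0 + 2 * Real.pi := not_lt.1 (Nat.find_min hex (by omega))
    have hA1 : A 1 = A 0 + θ 0 := by simpa using Asucc 0
    have hl0 : l ≠ 0 := by
      rintro rfl
      rw [hl, zero_add, hA1] at hm1
      linarith [θlt 0]
    have hne' : (0 : ZMod n) ≠ (l : ZMod n) := by
      intro e
      rw [eq_comm, ZMod.natCast_eq_zero_iff] at e
      exact absurd (Nat.le_of_dvd (by omega) e) (by omega)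
    rw [hl] at hm1
    obtain ⟨ε, hε0, hε1, hε2⟩ : ∃ ε > 0, A 0 + ε < A 1 ∧ A 0 + 2 * Real.pi + ε < A (l + 1) := by
      refine ⟨min (A 1 - A 0) (A (l + 1) - (A 0 + 2 * Real.pi)) / 2, ?_, ?_, ?_⟩
      · have : A 0 < A 1 := Amono one_pos
        have := lt_min (sub_pos.2 this) (sub_pos.2 hm1)
        linarith
      · have : A 0 < A 1 := Amono one_pos
        linarith [min_le_left (A 1 - A 0) (A (l + 1) - (A 0 + 2 * Real.pi))]
      · linarith [min_le_right (A 1 - A 0) (A (l + 1) - (A 0 + 2 * Real.pi))]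
    have b0 := hbA 0
    have b1 := hbA 1
    have bl := hbA l
    have bl1 := hbA (l + 1)
    push_cast at b0 b1 bl1
    have c0 : exp ((A 0 + ε : ℝ) * I) ∈ openCone (b 0) (b (0 + 1)) := by
      rw [zero_add]
      exact exp_mem_openCone (hb _) (hb _) b0 b1 (by linarith) hε1 (by linarith [θlt 0])
    have c1 : exp ((A 0 + 2 * Real.pi + ε : ℝ) * I) ∈ openCone (b l) (b (l + 1)) :=
      exp_mem_openCone (hb _) (hb _) bl bl1 (by linarith) hε2 (by linarith [θlt l, Asucc l])
    have e : exp ((A 0 + 2 * Real.pi + ε : ℝ) * I) = exp ((A 0 + ε : ℝ) * I) := by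
      rw [exp_eq_exp_iff_exists_int]
      exact ⟨1, by push_cast; ring⟩
    rw [e] at c1
    exact Set.disjoint_left.1 (hd 0 l hne') c0 c1
  calc ∑ k, InnerProductGeometry.angle (b k) (b (k + 1)) = ∑ k, θ k :=
        Finset.sum_congr rfl fun k _ => (angle_of_cross_pos (h k)).1
    _ = 2 * Real.pi := by rw [← hsum, hN, hN1]; simp

/-- Adjacent sectors without overlap have the same orientation. -/
lemma cross_pos_of_disjoint {a b c : ℂ} (h : 0 < cross a b) (h0 : cross b c ≠ 0)
    (hd : Disjoint (openCone a b) (openCone b c)) : 0 < cross b c := by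
  by_contra! hle
  have hlt := lt_of_le_of_ne hle h0
  set α := cross c a / cross b a with hα
  set β := cross b c / cross b a with hβ
  have hba : cross b a < 0 := by rw [cross_swap]; linarith
  have hba' := hba.ne
  have hc : c = α * b + β * a := by
    apply Complex.ext
    · simp only [add_re, re_ofReal_mul, hα, hβ]
      field_simp
      simp only [cross]
      ring
    · simp only [add_im, im_ofReal_mul, hα, hβ]
      field_simp
      simp only [cross]
      ring
  have hβ0 : 0 < β := div_pos_of_neg_of_neg hlt hba
  -- A reversed orientation puts `a` and `c` on the same side of `b`, so a point close enough in
  -- direction to `b` lies in both cones; `|α| + 1` makes both coefficients positive.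
  have p1 : ((|α| + 1 : ℝ) : ℂ) * b + (1 : ℝ) * c ∈ openCone b c :=
    ⟨|α| + 1, 1, by positivity, one_pos, rfl⟩
  refine Set.disjoint_left.1 hd ⟨β, |α| + 1 + α, hβ0, by linarith [neg_abs_le α], ?_⟩ p1
  rw [hc]
  push_cast
  ring

lemma cross_pos_of_forall_disjoint {n : ℕ} (hn : 2 ≤ n) [NeZero n] {b : ZMod n → ℂ}
    (h0 : ∀ k, cross (b k) (b (k + 1)) ≠ 0)
    (hd : ∀ k l, k ≠ l → Disjoint (openCone (b k) (b (k + 1))) (openCone (b l) (b (l + 1))))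
    (h : 0 < cross (b 0) (b (0 + 1))) (k : ZMod n) : 0 < cross (b k) (b (k + 1)) := by
  have : Fact (1 < n) := ⟨hn⟩
  have key : ∀ m : ℕ, 0 < cross (b m) (b (m + 1)) := by
    intro m
    induction m with
    | zero => simpa using h
    | succ m ih =>
      push_cast
      exact cross_pos_of_disjoint ih (h0 _) (hd _ _ (by simp))
  simpa using key k.val

/-- Disjoint sectors, one after the other, form a fan around the origin. -/
theorem fan_of_disjoint {n : ℕ} (hn : 2 ≤ n) [NeZero n] {b : ZMod n → ℂ}
    (h0 : ∀ k, cross (b k) (b (k + 1)) ≠ 0)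
    (hd : ∀ k l, k ≠ l → Disjoint (openCone (b k) (b (k + 1))) (openCone (b l) (b (l + 1)))) :
    ((∀ k, 0 < cross (b k) (b (k + 1))) ∨ ∀ k, cross (b k) (b (k + 1)) < 0) ∧
      ∑ k, InnerProductGeometry.angle (b k) (b (k + 1)) = 2 * Real.pi := by
  rcases (h0 0).lt_or_gt with hlt | hgt
  · have e : ∀ k, cross (starRingEnd ℂ (b k)) (starRingEnd ℂ (b (k + 1))) = -cross (b k) (b (k + 1)) :=
      fun k => cross_conj _ _
    have hd' : ∀ k l, k ≠ l →
        Disjoint (openCone (starRingEnd ℂ (b k)) (starRingEnd ℂ (b (k + 1))))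
          (openCone (starRingEnd ℂ (b l)) (starRingEnd ℂ (b (l + 1)))) := by
      intro k l hkl
      rw [Set.disjoint_left]
      intro p h1 h2
      rw [← conj_conj p] at h1 h2
      exact Set.disjoint_left.1 (hd k l hkl) (conj_mem_openCone h1) (conj_mem_openCone h2)
    have hpos := cross_pos_of_forall_disjoint hn (b := fun k => starRingEnd ℂ (b k))
      (fun k => by simpa [e] using h0 k) hd' (by rw [e]; linarith)
    refine ⟨Or.inr fun k => ?_, ?_⟩
    · have := hpos k
      rw [e] at this
      linarith
    · have := sum_angle_eq_two_pi hn hpos hd'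
      rw [← this]
      refine Finset.sum_congr rfl fun k _ => ?_
      exact (LinearIsometry.angle_map conjLIE.toLinearIsometry (b k) (b (k + 1))).symm
  · have hpos := cross_pos_of_forall_disjoint hn h0 hd hgt
    exact ⟨Or.inl hpos, sum_angle_eq_two_pi hn hpos hd⟩

end Sectors

/-! ### Straight embeddings of triangles. -/

section Triangles

variable {V : Type*} [DecidableEq V]

/-- The point with barycentric coordinates `x`, `y`, `z` of the triangle `i a b`. -/
noncomputable def trianglePoint (i a b : V) (x y z : ℝ) : V → ℝ :=
  x • vertexPoint i + y • vertexPoint a + z • vertexPoint b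

lemma vertexPoint_nonneg (a v : V) : 0 ≤ vertexPoint a v := by
  rw [vertexPoint, Pi.single_apply]
  split_ifs <;> norm_num

lemma trianglePoint_mem_realization {K : PreAbstractSimplicialComplex V} {i a b : V}
    (h : IsTriangle K i a b) {x y z : ℝ} (hx : 0 ≤ x) (hy : 0 ≤ y) (hz : 0 ≤ z) (hs : x + y + z = 1) :
    trianglePoint i a b x y z ∈ realization K := by
  obtain ⟨hia, hib, hab, hK⟩ := h
  refine ⟨_, hK, fun v hv => ?_, fun v => ?_, ?_⟩
  · simp only [Finset.mem_insert, Finset.mem_singleton, not_or] at hv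
    simp [trianglePoint, vertexPoint, hv.1, hv.2.1, hv.2.2]
  · simp only [trianglePoint, Pi.add_apply, Pi.smul_apply, smul_eq_mul]
    have := vertexPoint_nonneg i v
    have := vertexPoint_nonneg a v
    have := vertexPoint_nonneg b v
    positivity
  · rw [Finset.sum_insert (by simp [hia, hib]), Finset.sum_insert (by simp [hab]),
      Finset.sum_singleton]
    simp [trianglePoint, vertexPoint, hia, hib, hab, hia.symm, hib.symm, hab.symm]
    linarith

lemma segment_vertexPoint_subset {K : PreAbstractSimplicialComplex V} {a b : V} (h : IsEdge K a b) :
    segment ℝ (vertexPoint a) (vertexPoint b) ⊆ realization K := by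
  rintro _ ⟨x, y, hx, hy, hxy, rfl⟩
  obtain ⟨hab, hK⟩ := h
  refine ⟨_, hK, fun v hv => ?_, fun v => ?_, ?_⟩
  · simp only [Finset.mem_insert, Finset.mem_singleton, not_or] at hv
    simp [vertexPoint, hv.1, hv.2]
  · simp only [Pi.add_apply, Pi.smul_apply, smul_eq_mul]
    have := vertexPoint_nonneg a v
    have := vertexPoint_nonneg b v
    positivity
  · rw [Finset.sum_insert (by simp [hab]), Finset.sum_singleton]
    simp [vertexPoint, hab, hab.symm, hxy]

lemma IsTriangle.isEdge {K : PreAbstractSimplicialComplex V} {a b c : V} (h : IsTriangle K a b c) :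
    IsEdge K a b :=
  ⟨h.1, (K.isRelLowerSet_faces h.2.2.2).2 (by intro v; simp; tauto) (by simp)⟩

lemma IsTriangle.rotate {K : PreAbstractSimplicialComplex V} {a b c : V} (h : IsTriangle K a b c) :
    IsTriangle K b c a := by
  refine ⟨h.2.2.1, h.1.symm, h.2.1.symm, ?_⟩
  have e : ({b, c, a} : Finset V) = {a, b, c} := by ext v; simp; tauto
  rw [e]
  exact h.2.2.2

lemma IsTriangle.swap {K : PreAbstractSimplicialComplex V} {a b c : V} (h : IsTriangle K a b c) :
    IsTriangle K a c b := by
  refine ⟨h.2.1, h.1, h.2.2.1.symm, ?_⟩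
  rw [Finset.pair_comm c b]
  exact h.2.2.2

/-- A continuous injective map of the underlying space of `K` to the plane which maps the edges into
straight segments. -/
structure IsStraightEmbedding (K : PreAbstractSimplicialComplex V) (ψ : (V → ℝ) → ℂ) : Prop where
  continuousOn : ContinuousOn ψ (realization K)
  injOn : Set.InjOn ψ (realization K)
  mem_segment : ∀ a b, IsEdge K a b → ∀ x ∈ segment ℝ (vertexPoint a) (vertexPoint b),
    ψ x ∈ segment ℝ (ψ (vertexPoint a)) (ψ (vertexPoint b))

variable {K : PreAbstractSimplicialComplex V} {ψ : (V → ℝ) → ℂ}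

/-- The image of the edge `a b` fills the whole segment, so by injectivity no other vertex of the
triangle can land there. -/
lemma IsStraightEmbedding.notMem_segment (h : IsStraightEmbedding K ψ) {a b c : V}
    (ht : IsTriangle K a b c) :
    ψ (vertexPoint c) ∉ segment ℝ (ψ (vertexPoint a)) (ψ (vertexPoint b)) := by
  intro hc
  set γ : ℝ → V → ℝ := fun t => (1 - t) • vertexPoint a + t • vertexPoint b with hγ
  have hγs : ∀ t ∈ Set.Icc (0 : ℝ) 1, γ t ∈ segment ℝ (vertexPoint a) (vertexPoint b) :=
    fun t ht => ⟨1 - t, t, by linarith [ht.2], ht.1, by ring, rfl⟩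
  have hγr : ∀ t ∈ Set.Icc (0 : ℝ) 1, γ t ∈ realization K := fun t h =>
    segment_vertexPoint_subset ht.isEdge (hγs t h)
  have hγc : Continuous γ := by fun_prop
  obtain ⟨t, h1, h2⟩ := exists_eq_of_mem_segment (γ := fun t => ψ (γ t))
    (h.continuousOn.comp hγc.continuousOn hγr) (fun t h' => h.mem_segment a b ht.isEdge _ (hγs t h'))
    (by simp [hγ]) (by simp [hγ]) hc
  have hcr : vertexPoint c ∈ realization K :=
    segment_vertexPoint_subset ht.rotate.isEdge (right_mem_segment _ _ _)
  have e := congrFun (h.injOn (hγr t h1) hcr h2) c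
  simp [hγ, vertexPoint, ht.2.1.symm, ht.2.2.1.symm] at e

/-- Of three collinear points one lies between the other two, which `notMem_segment` forbids for
each corner. -/
lemma IsStraightEmbedding.cross_ne_zero (h : IsStraightEmbedding K ψ) {i a b : V}
    (h0 : ψ (vertexPoint i) = 0) (ht : IsTriangle K i a b) :
    cross (ψ (vertexPoint a)) (ψ (vertexPoint b)) ≠ 0 := by
  intro hx
  have h1 := h.notMem_segment ht
  have h2 := h.notMem_segment ht.swap
  have h3 := h.notMem_segment ht.rotate
  rw [h0] at h1 h2 h3
  set A := ψ (vertexPoint a)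
  set B := ψ (vertexPoint b)
  have hA : A ≠ 0 := fun e => h2 (e ▸ left_mem_segment _ _ _)
  set c := (B / A).re with hc
  have e : B = c * A := by
    rw [← div_eq_iff hA]
    exact Complex.ext (by simp [hc]) (by rw [im_div_eq_cross, hx]; simp)
  rcases le_or_gt c 0 with hc0 | hc0
  · have p : 0 < 1 - c := by linarith
    have p' : (1 : ℂ) - c ≠ 0 := by exact_mod_cast p.ne'
    refine h3 ⟨-c / (1 - c), 1 / (1 - c), div_nonneg (by linarith) p.le, by positivity, ?_, ?_⟩
    · field_simp
      ring
    · rw [e]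
      simp only [Complex.real_smul]
      push_cast
      field_simp
      ring
  rcases le_or_gt c 1 with hc1 | hc1
  · exact h1 ⟨1 - c, c, by linarith, hc0.le, by ring, by rw [e]; simp⟩
  · refine h2 ⟨1 - 1 / c, 1 / c, ?_, by positivity, by ring, ?_⟩
    · rw [sub_nonneg, div_le_one hc0]
      exact hc1.le
    · have p : (c : ℂ) ≠ 0 := by exact_mod_cast hc0.ne'
      rw [e]
      simp only [Complex.real_smul]
      push_cast
      field_simp
      simp

/-- Only edges are known to map to straight segments, so that a triangle covers its straight image
is topological (`exists_eq_of_cross`). The coordinate conditions record which triangle contains the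
preimage. -/
lemma IsStraightEmbedding.exists_preimage (h : IsStraightEmbedding K ψ) {i a b : V}
    (h0 : ψ (vertexPoint i) = 0) (ht : IsTriangle K i a b) {x y : ℝ} (hx : 0 < x) (hy : 0 < y)
    (hxy : x + y < 1) :
    ∃ X ∈ realization K, ψ X = x * ψ (vertexPoint a) + y * ψ (vertexPoint b) ∧
      (∀ v, v ≠ i → v ≠ a → v ≠ b → X v = 0) ∧ X a ≠ 0 ∧ X b ≠ 0 := by
  have hcr := h.cross_ne_zero h0 ht
  have eab := ht.rotate.isEdge
  have eia := ht.isEdge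
  have eib := ht.swap.isEdge
  set A := ψ (vertexPoint a) with hA
  set B := ψ (vertexPoint b) with hB
  -- Clamping to `[0, 1]` extends the parametrized triangle to the whole plane, where the logarithm
  -- is lifted.
  set c : ℝ → ℝ := fun s => max 0 (min 1 s) with hc
  have c0 : ∀ s, 0 ≤ c s := fun s => le_max_left _ _
  have c1 : ∀ s, c s ≤ 1 := fun s => max_le zero_le_one (min_le_left _ _)
  have cc : Continuous c := by fun_prop
  have cz : c 0 = 0 := by simp [hc]
  have co : c 1 = 1 := by simp [hc]
  set P : ℝ × ℝ → V → ℝ := fun q =>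
    trianglePoint i a b (1 - c q.1) (c q.1 * (1 - c q.2)) (c q.1 * c q.2) with hP
  have hPr : ∀ q, P q ∈ realization K := fun q =>
    trianglePoint_mem_realization ht (by linarith [c1 q.1])
      (mul_nonneg (c0 _) (by linarith [c1 q.2])) (mul_nonneg (c0 _) (c0 _)) (by ring)
  have hPc : Continuous P := by
    unfold P trianglePoint
    fun_prop
  have sA : ∀ q, c q.1 * c q.2 = 0 → ψ (P q) ∈ segment ℝ 0 A := by
    intro q hq
    rw [← h0]
    refine h.mem_segment i a eia _
      ⟨1 - c q.1, c q.1 * (1 - c q.2), by linarith [c1 q.1], mul_nonneg (c0 _) (by linarith [c1 q.2]),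
        by rw [mul_sub, hq]; ring, ?_⟩
    simp [hP, trianglePoint, hq]
  have sB : ∀ q, c q.1 * (1 - c q.2) = 0 → ψ (P q) ∈ segment ℝ 0 B := by
    intro q hq
    rw [← h0]
    refine h.mem_segment i b eib _
      ⟨1 - c q.1, c q.1 * c q.2, by linarith [c1 q.1], mul_nonneg (c0 _) (c0 _), by linarith, ?_⟩
    simp [hP, trianglePoint, hq]
  have sAB : ∀ t, ψ (P (1, t)) ∈ segment ℝ A B := by
    intro t
    refine h.mem_segment a b eab _ ⟨1 - c t, c t, by linarith [c1 t], c0 _, by ring, ?_⟩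
    simp [hP, trianglePoint, co]
  set p : ℂ := x * A + y * B with hp
  have e1 : cross (0 - p) (A - p) = y * cross A B := by simp [hp, cross]; ring
  have e2 : cross (A - p) (B - p) = (1 - x - y) * cross A B := by simp [hp, cross]; ring
  have e3 : cross (B - p) (0 - p) = x * cross A B := by simp [hp, cross]; ring
  have hz : 0 < 1 - x - y := by linarith
  obtain ⟨q, hq⟩ := exists_eq_of_cross (A := 0) (B := A) (C := B) (p := p) (F := fun q => ψ (P q))
    (h.continuousOn.comp_continuous hPc hPr) (fun s _ => sA _ (by simp [cz])) (fun t _ => sAB t)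
    (fun s _ => sB _ (by simp [co])) (fun t => by simp [hP, trianglePoint, cz, h0])
    (by simp [hP, trianglePoint, cz, co, hA]) (by simp [hP, trianglePoint, co, hB]) (by
      rw [e1, e2, e3]
      rcases hcr.lt_or_gt with hl | hg
      · exact Or.inr ⟨mul_neg_of_pos_of_neg hy hl, mul_neg_of_pos_of_neg hz hl,
          mul_neg_of_pos_of_neg hx hl⟩
      · exact Or.inl ⟨mul_pos hy hg, mul_pos hz hg, mul_pos hx hg⟩)
  obtain ⟨hia, hib, hab, -⟩ := ht
  refine ⟨P q, hPr q, hq, fun v h1 h2 h3 => ?_, fun hX => ?_, fun hX => ?_⟩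
  · simp [hP, trianglePoint, vertexPoint, h1, h2, h3]
  · have hX' : c q.1 * (1 - c q.2) = 0 := by
      simpa [hP, trianglePoint, vertexPoint, hia.symm, hab] using hX
    have := cross_sub_sub_eq_zero (sB q hX')
    rw [hq, cross_swap, e3] at this
    exact mul_ne_zero hx.ne' hcr (neg_eq_zero.1 this)
  · have hX' : c q.1 * c q.2 = 0 := by
      simpa [hP, trianglePoint, vertexPoint, hib.symm, hab.symm] using hX
    have := cross_sub_sub_eq_zero (sA q hX')
    rw [hq, e1] at this
    exact mul_ne_zero hy.ne' hcr this

lemma smul_mem_triangle {a b p : ℂ} (h : p ∈ openCone a b) : ∃ ε > (0 : ℝ), ∀ δ : ℝ, 0 < δ → δ ≤ ε →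
    ∃ x y : ℝ, 0 < x ∧ 0 < y ∧ x + y < 1 ∧ δ * p = x * a + y * b := by
  obtain ⟨x, y, hx, hy, e⟩ := h
  refine ⟨1 / (2 * (x + y)), by positivity, fun δ h0 h1 => ⟨δ * x, δ * y, by positivity, by positivity,
    ?_, ?_⟩⟩
  · rw [le_div_iff₀ (by positivity)] at h1
    nlinarith
  · rw [e]
    push_cast
    ring

/-- The images of two triangles with a common corner at the origin span sectors without overlap. -/
lemma IsStraightEmbedding.disjoint_openCone (h : IsStraightEmbedding K ψ) {i a b c d : V}
    (h0 : ψ (vertexPoint i) = 0) (ht : IsTriangle K i a b) (ht' : IsTriangle K i c d)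
    (hne : (a ≠ c ∧ a ≠ d) ∨ (b ≠ c ∧ b ≠ d)) :
    Disjoint (openCone (ψ (vertexPoint a)) (ψ (vertexPoint b)))
      (openCone (ψ (vertexPoint c)) (ψ (vertexPoint d))) := by
  rw [Set.disjoint_left]
  intro p h1 h2
  obtain ⟨ε, hε, H⟩ := smul_mem_triangle h1
  obtain ⟨ε', hε', H'⟩ := smul_mem_triangle h2
  -- A common point of the cones is shrunk until it lies in both straight triangles; its two
  -- preimages then coincide but have different supports.
  obtain ⟨x, y, hx, hy, hxy, e⟩ := H (min ε ε') (lt_min hε hε') (min_le_left _ _)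
  obtain ⟨x', y', hx', hy', hxy', e'⟩ := H' (min ε ε') (lt_min hε hε') (min_le_right _ _)
  obtain ⟨X, hX, eX, -, na, nb⟩ := h.exists_preimage h0 ht hx hy hxy
  obtain ⟨Y, hY, eY, vY, -, -⟩ := h.exists_preimage h0 ht' hx' hy' hxy'
  have hXY : X = Y := h.injOn hX hY (by rw [eX, eY, ← e, ← e'])
  subst hXY
  rcases hne with hne | hne
  · exact na (vY a ht.1.symm hne.1 hne.2)
  · exact nb (vY b ht.2.1.symm hne.1 hne.2)

end Triangles

/-! ### Scaling and reflecting convex fans. -/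

lemma heron_scale (c L x y : ℝ) : heron (c * L) (c * x) (c * y) = c ^ 2 * heron L x y := by
  unfold heron; ring

lemma apexAngle_scale {c L x y : ℝ} (hc : 0 < c) :
    apexAngle (c * L) (c * x) (c * y) = apexAngle L x y := by
  have e : Real.sqrt (c * x * (c * y)) = c * Real.sqrt (x * y) := by
    rw [show c * x * (c * y) = c ^ 2 * (x * y) by ring, Real.sqrt_mul (by positivity),
      Real.sqrt_sq hc.le]
  unfold apexAngle
  rw [e, ← mul_add, ← mul_sub, mul_left_comm, mul_div_mul_left _ _ hc.ne']

lemma IsConvexFan.scale {n : ℕ} [NeZero n] {l s : ZMod n → ℝ} (h : IsConvexFan l s) {c : ℝ}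
    (hc : 0 < c) : IsConvexFan (fun k => c * l k) (fun k => c ^ 2 * s k) := by
  refine ⟨fun k => mul_pos (pow_pos hc 2) (h.pos k), fun k => ?_, fun k => ?_, ?_⟩
  · simp only [mul_pow]
    rw [heron_scale]
    exact mul_pos (by positivity) (h.heron_pos k)
  · have aux : ∀ x y l : ℝ, (c ^ 2 * x - c ^ 2 * y + (c * l) ^ 2) / (c * l) =
        c * ((x - y + l ^ 2) / l) := fun x y l => by
      rw [show c ^ 2 * x - c ^ 2 * y + (c * l) ^ 2 = c * (c * (x - y + l ^ 2)) by ring,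
        mul_div_mul_left _ _ hc.ne', mul_div_assoc]
    rw [aux, aux, ← mul_add]
    exact mul_nonneg hc.le (h.convex k)
  · simp only [mul_pow]
    rw [← h.sum_angle]
    exact Finset.sum_congr rfl fun k _ => apexAngle_scale (by positivity)

lemma isConvexFan_of_star {n : ℕ} [NeZero n] {w : ZMod n → ℂ} {q : ℂ} (hq : ∀ k, w k ≠ q)
    (h : (∀ k, 0 < cross (w k) (w (k + 1))) ∨ ∀ k, cross (w k) (w (k + 1)) < 0)
    (h1 : ∀ k, 0 ≤ cross (w k - q) (w (k + 1) - q) * cross (w k - w (k - 1)) (w (k + 1) - w k))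
    (h2 : ∀ k, 0 ≤ cross (w (k - 1) - q) (w k - q) * cross (w k - w (k - 1)) (w (k + 1) - w k))
    (hsum : ∑ k, InnerProductGeometry.angle (w k) (w (k + 1)) = 2 * Real.pi) :
    IsConvexFan (fun k => ‖w k - w (k + 1)‖) (fun k => ‖w k‖ ^ 2) := by
  rcases h with h | h
  · exact isConvexFan_of_cross h (convex_of_star hq h h1 h2) hsum
  · have hpos : ∀ k, 0 < cross (starRingEnd ℂ (w k)) (starRingEnd ℂ (w (k + 1))) := fun k => by
      rw [cross_conj]; linarith [h k]
    have := isConvexFan_of_cross (w := fun k => starRingEnd ℂ (w k)) hpos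
      (convex_of_star (w := fun k => starRingEnd ℂ (w k)) (q := starRingEnd ℂ q)
        (fun k => (RingHom.injective _).ne (hq k)) hpos
        (fun k => by simp only [← map_sub, cross_conj, neg_mul_neg]; exact h1 k)
        (fun k => by simp only [← map_sub, cross_conj, neg_mul_neg]; exact h2 k))
      (by
        rw [← hsum]
        exact Finset.sum_congr rfl fun k _ =>
          LinearIsometry.angle_map Complex.conjLIE.toLinearIsometry (w k) (w (k + 1)))
    simpa only [← map_sub, RCLike.norm_conj] using this

/-! ### Combinatorics of the one-ring. -/

section OneRing

variable {V : Type*} [DecidableEq V]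

/-- The link of `i` in `T` is the cycle `j`. -/
structure IsCycleLink (T : PreAbstractSimplicialComplex V) (i : V) {n : ℕ} (j : ZMod n → V) :
    Prop where
  three_le : 3 ≤ n
  injective : Function.Injective j
  link : linkFaces T i = {s | ∃ k : ZMod n, s = {j k} ∨ s = {j k, j (k + 1)}}

variable {T : PreAbstractSimplicialComplex V} {i : V} {n : ℕ} {j : ZMod n → V}

lemma mem_oneRing {s : Finset V} : s ∈ oneRing T i ↔ s.Nonempty ∧ insert i s ∈ T := Iff.rfl

lemma IsCycleLink.edge_mem (h : IsCycleLink T i j) (k : ZMod n) :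
    ({j k, j (k + 1)} : Finset V) ∈ linkFaces T i := by
  rw [h.link]
  exact ⟨k, Or.inr rfl⟩

lemma IsCycleLink.ne (h : IsCycleLink T i j) (k : ZMod n) : j k ≠ i := by
  rintro rfl
  exact (h.edge_mem k).2.1 (by simp)

lemma IsCycleLink.succ_ne (h : IsCycleLink T i j) (k : ZMod n) : j k ≠ j (k + 1) := by
  have : Fact (1 < n) := ⟨by have := h.three_le; omega⟩
  exact h.injective.ne (by simp)

lemma IsCycleLink.isTriangle (h : IsCycleLink T i j) (k : ZMod n) :
    IsTriangle (oneRing T i) i (j k) (j (k + 1)) :=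
  ⟨(h.ne k).symm, (h.ne _).symm, h.succ_ne k,
    mem_oneRing.2 ⟨by simp, by simpa using (h.edge_mem k).2.2⟩⟩

lemma IsCycleLink.natCast_two_ne_zero (h : IsCycleLink T i j) : (2 : ZMod n) ≠ 0 := by
  have h3 := h.three_le
  intro e
  have e' : ((2 : ℕ) : ZMod n) = 0 := by exact_mod_cast e
  rw [ZMod.natCast_eq_zero_iff] at e'
  exact absurd (Nat.le_of_dvd (by omega) e') (by omega)

lemma IsCycleLink.pred_ne_succ (h : IsCycleLink T i j) (k : ZMod n) : j (k - 1) ≠ j (k + 1) := by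
  refine h.injective.ne fun e => h.natCast_two_ne_zero ?_
  linear_combination -e

lemma IsCycleLink.vertexSet_eq (h : IsCycleLink T i j) :
    vertexSet (oneRing T i) = insert i (Set.range j) := by
  have hi : ({i} : Finset V) ∈ T :=
    (T.isRelLowerSet_faces (h.edge_mem 0).2.2).2 (by simp) (by simp)
  ext v
  simp only [vertexSet, Set.mem_ofPred_eq, mem_oneRing, Set.mem_insert_iff, Set.mem_range]
  constructor
  · rintro ⟨-, hv⟩
    by_cases hvi : v = i
    · exact Or.inl hvi
    · right
      have : ({v} : Finset V) ∈ linkFaces T i :=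
        ⟨by simp, by simpa using Ne.symm hvi, hv⟩
      rw [h.link] at this
      obtain ⟨k, e | e⟩ := this
      · exact ⟨k, by simpa using e.symm⟩
      · exact ⟨k, by
          have : j k ∈ ({v} : Finset V) := e ▸ by simp
          simpa using this⟩
  · rintro (rfl | ⟨k, rfl⟩)
    · exact ⟨by simp, by simpa using hi⟩
    · refine ⟨by simp, (T.isRelLowerSet_faces (h.edge_mem k).2.2).2 ?_ (by simp)⟩
      intro v
      simp
      tauto

lemma IsCycleLink.isCycleLink_oneRing (h : IsCycleLink T i j) : IsCycleLink (oneRing T i) i j := by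
  refine ⟨h.three_le, h.injective, ?_⟩
  rw [← h.link]
  ext s
  simp [linkFaces, mem_oneRing]

/-- Every edge in the link of `j k` within the one-ring contains `i`, since otherwise the link of
`i` would have a face with three vertices. A cycle of length at least three also has edges avoiding
any given vertex. -/
lemma IsCycleLink.not_isInteriorVertex (h : IsCycleLink T i j) (k : ZMod n) :
    ¬ IsInteriorVertex (oneRing T i) (j k) := by
  rintro ⟨n', h3, j', hj', hl⟩
  have h' : IsCycleLink (oneRing T i) (j k) j' := ⟨h3, hj', hl⟩
  have key : ∀ m, j' m = i ∨ j' (m + 1) = i := by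
    intro m
    by_contra! hm
    obtain ⟨-, hk, hT⟩ := h'.edge_mem m
    have mem : ({j k, j' m, j' (m + 1)} : Finset V) ∈ linkFaces T i := by
      refine ⟨by simp, ?_, (mem_oneRing.1 hT).2⟩
      simp only [Finset.mem_insert, Finset.mem_singleton, not_or]
      exact ⟨(h.ne k).symm, hm.1.symm, hm.2.symm⟩
    have card : ({j k, j' m, j' (m + 1)} : Finset V).card = 3 :=
      Finset.card_eq_three.2 ⟨_, _, _, by simp at hk; exact hk.1, by simp at hk; exact hk.2,
        h'.succ_ne m, rfl⟩
    rw [h.link] at mem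
    obtain ⟨l, e | e⟩ := mem
    · rw [e] at card
      simp at card
    · rw [e] at card
      have := Finset.card_le_two (a := j l) (b := j (l + 1))
      omega
  have : Fact (1 < n') := ⟨by omega⟩
  rcases key 0 with e | e
  · rcases key 1 with e' | e'
    · exact absurd (hj' (e.trans e'.symm)) (by simp)
    · refine h'.natCast_two_ne_zero ?_
      have := hj' (e.trans e'.symm)
      rw [← one_add_one_eq_two]
      exact this.symm
  · rcases key (0 + 1 + 1) with e' | e'
    · exact absurd (hj' (e.trans e'.symm)) (by simp)
    · have := hj' (e.trans e'.symm)
      refine h'.natCast_two_ne_zero ?_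
      linear_combination -this

lemma IsCycleLink.boundaryVertexSet_eq (h : IsCycleLink T i j) :
    boundaryVertexSet (oneRing T i) = Set.range j := by
  ext v
  simp only [boundaryVertexSet, h.vertexSet_eq, Set.mem_ofPred_eq, Set.mem_insert_iff]
  constructor
  · rintro ⟨rfl | hv, hn⟩
    · exact absurd ⟨n, h.three_le, j, h.injective, h.isCycleLink_oneRing.link⟩ hn
    · exact hv
  · rintro ⟨k, rfl⟩
    exact ⟨Or.inr ⟨k, rfl⟩, h.not_isInteriorVertex k⟩

/-! ### From embeddings to convex fans, and the maximum principle. -/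

lemma IsHypGeodesicEmbedding.isStraightEmbedding {K : PreAbstractSimplicialComplex V}
    {φ : (V → ℝ) → Complex.UnitDisc} (h : IsHypGeodesicEmbedding K φ) (a : Complex.UnitDisc) :
    IsStraightEmbedding K fun x => klein (moebius a (φ x)) := by
  refine ⟨?_, ?_, fun b c hbc x hx => ?_⟩
  · exact (continuous_klein_moebius a).comp_continuousOn
      (continuousOn_iff_continuous_domRestrict.2 h.1.continuous)
  · intro x hx y hy hxy
    have := klein_moebius_injective a hxy
    exact congrArg Subtype.val (@h.1.injective ⟨x, hx⟩ ⟨y, hy⟩ this)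
  · refine klein_moebius_mem_segment a ?_
    rw [← h.2 b c hbc]
    exact ⟨x, hx, rfl⟩

lemma vertexPoint_mem_realization {K : PreAbstractSimplicialComplex V} {a b : V} (h : IsEdge K a b) :
    vertexPoint a ∈ realization K :=
  segment_vertexPoint_subset h (left_mem_segment _ _ _)

lemma IsHypGeodesicEmbedding.ne {K : PreAbstractSimplicialComplex V}
    {φ : (V → ℝ) → Complex.UnitDisc} (h : IsHypGeodesicEmbedding K φ) {a b : V} (hab : IsEdge K a b) :
    φ (vertexPoint b) ≠ φ (vertexPoint a) := by
  intro e
  have := @h.1.injective ⟨_, segment_vertexPoint_subset hab (right_mem_segment _ _ _)⟩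
    ⟨_, vertexPoint_mem_realization hab⟩ e
  have := congrFun (congrArg Subtype.val this) a
  simp [vertexPoint, hab.1] at this

/-- The spokes of a Delaunay hyperbolic geodesic embedding of a one-ring form, after the inversion in
the unit circle, a convex fan. -/
theorem IsCycleLink.isConvexFan [NeZero n] (h : IsCycleLink T i j) {φ : (V → ℝ) → Complex.UnitDisc}
    (hφ : IsHypGeodesicEmbedding (oneRing T i) φ) (hD : IsHypDelaunay (oneRing T i) φ) :
    IsConvexFan
      (fun k => ‖farPoint (φ (vertexPoint i)) (φ (vertexPoint (j k))) -
        farPoint (φ (vertexPoint i)) (φ (vertexPoint (j (k + 1))))‖)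
      (fun k => ‖farPoint (φ (vertexPoint i)) (φ (vertexPoint (j k)))‖ ^ 2) := by
  set a := φ (vertexPoint i) with ha
  have hψ := hφ.isStraightEmbedding a
  have h0 : klein (moebius a (φ (vertexPoint i))) = 0 := by simp [← ha, moebius, klein]
  have hne : ∀ k, φ (vertexPoint (j k)) ≠ a := fun k => hφ.ne (h.isTriangle k).isEdge
  have hne' : ∀ k, (φ (vertexPoint (j k)) : ℂ) ≠ a := fun k =>
    Complex.UnitDisc.coe_injective.ne (hne k)
  have hn : 2 ≤ n := by have := h.three_le; omega
  obtain ⟨hor, hsum⟩ := fan_of_disjoint hn (b := fun k => klein (moebius a (φ (vertexPoint (j k)))))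
    (fun k => hψ.cross_ne_zero h0 (h.isTriangle k))
    (fun k l hkl => hψ.disjoint_openCone h0 (h.isTriangle k) (h.isTriangle l) (by
      -- Distinct triangles of the ring differ in a corner: `j k` works unless `k = l + 1`, and then
      -- `j (k + 1)` does because `n ≥ 3`.
      by_cases h1 : k = l + 1
      · right
        subst h1
        refine ⟨h.injective.ne fun e => h.natCast_two_ne_zero ?_, (h.succ_ne _).symm⟩
        linear_combination e
      · exact Or.inl ⟨h.injective.ne hkl, h.injective.ne h1⟩))
  choose c hc hw using fun k => farPoint_eq_mul_klein (hne k)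
  have hlam := one_sub_normSq_pos a
  set w : ZMod n → ℂ := fun k => farPoint a (φ (vertexPoint (j k))) with hwdef
  have hcross : ∀ k, cross (w k) (w (k + 1)) = c k * c (k + 1) *
      cross (klein (moebius a (φ (vertexPoint (j k))))) (klein (moebius a (φ (vertexPoint (j (k + 1)))))) :=
    fun k => by
      simp only [hwdef]
      rw [hw, hw, cross_real_smul]
  set v : ZMod n → ℂ := fun k => invCircle (φ (vertexPoint (j k)) - a) with hv
  have hwv : ∀ k l, w k - w l = ((1 - Complex.normSq (a : ℂ) : ℝ) : ℂ) * (v k - v l) := fun k l => by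
    simp only [hwdef, hv, farPoint]
    ring
  have hwq : ∀ k, w k - (-(a : ℂ)) = ((1 - Complex.normSq (a : ℂ) : ℝ) : ℂ) * v k := fun k => by
    simp only [hwdef, hv, farPoint]
    ring
  have hprev : ∀ k, IsTriangle (oneRing T i) i (j k) (j (k - 1)) := fun k => by
    have := h.isTriangle (k - 1)
    rw [sub_add_cancel] at this
    exact this.swap
  have d1 : ∀ k, 0 ≤ cross (v k) (v (k + 1)) * cross (v (k + 1) - v k) (v (k - 1) - v k) := fun k =>
    delaunay_inversion (hne' _) (hne' _) (hne' _)
      (hD _ _ _ _ (h.isTriangle k) (hprev k) (h.pred_ne_succ k).symm)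
  have d2 : ∀ k, 0 ≤ cross (v k) (v (k - 1)) * cross (v (k - 1) - v k) (v (k + 1) - v k) := fun k =>
    delaunay_inversion (hne' _) (hne' _) (hne' _)
      (hD _ _ _ _ (hprev k) (h.isTriangle k) (h.pred_ne_succ k))
  set lam := 1 - Complex.normSq (a : ℂ) with hlamdef
  have eX : ∀ k, cross (w k - w (k - 1)) (w (k + 1) - w k) =
      lam * lam * cross (v (k + 1) - v k) (v (k - 1) - v k) := fun k => by
    rw [hwv, hwv, cross_real_smul]
    simp only [cross, Complex.sub_re, Complex.sub_im]
    ring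
  -- `w` is the affine image of the inverted points `v` sending the centre of inversion `0` to `-a`,
  -- so the Delaunay condition refers to `q = -a`.
  refine isConvexFan_of_star (w := w) (q := -(a : ℂ)) (fun k e => ?_) ?_ (fun k => ?_) (fun k => ?_) ?_
  · have := hwq k
    rw [e, sub_self, eq_comm, mul_eq_zero] at this
    rcases this with e1 | e1
    · exact hlam.ne' (by exact_mod_cast e1)
    · simp only [hv, invCircle, one_div, inv_eq_zero, map_eq_zero, sub_eq_zero] at e1
      exact hne' k e1
  · rcases hor with hor | hor
    · exact Or.inl fun k => by
        rw [hcross]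
        exact mul_pos (mul_pos (hc _) (hc _)) (hor k)
    · exact Or.inr fun k => by
        rw [hcross]
        exact mul_neg_of_pos_of_neg (mul_pos (hc _) (hc _)) (hor k)
  · rw [eX, hwq, hwq, cross_real_smul, mul_mul_mul_comm]
    exact mul_nonneg (by positivity) (d1 k)
  · rw [eX, hwq, hwq, cross_real_smul, mul_mul_mul_comm]
    refine mul_nonneg (by positivity) ((d2 k).trans_eq ?_)
    rw [cross_swap (v (k - 1)) (v k), cross_swap (v (k + 1) - v k), neg_mul_neg]
  · rw [← hsum]
    refine Finset.sum_congr rfl fun k _ => ?_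
    simp only [hwdef]
    rw [hw k, hw (k + 1), ← Complex.real_smul, ← Complex.real_smul,
      InnerProductGeometry.angle_smul_left_of_pos _ _ (hc _),
      InnerProductGeometry.angle_smul_right_of_pos _ _ (hc _)]

/-- If the conformal factor at the centre is a nonpositive minimum, it vanishes everywhere. -/
theorem IsCycleLink.conformalFactor_eq_zero [NeZero n] (h : IsCycleLink T i j)
    {φ φ' : (V → ℝ) → Complex.UnitDisc}
    (hφ : IsHypGeodesicEmbedding (oneRing T i) φ)
    (hφ' : IsHypGeodesicEmbedding (oneRing T i) φ')
    (hD : IsHypDelaunay (oneRing T i) φ) (hD' : IsHypDelaunay (oneRing T i) φ')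
    {u : V → ℝ} (hu : IsHypConformal (oneRing T i) (inducedLength φ) (inducedLength φ') u)
    (h0 : u i ≤ 0) (hle : ∀ k, u i ≤ u (j k)) : u i = 0 ∧ ∀ k, u (j k) = 0 := by
  set S : V → V → ℝ := fun a b => Real.sinh (inducedLength φ a b / 2) ^ 2 with hS
  set S' : V → V → ℝ := fun a b => Real.sinh (inducedLength φ' a b / 2) ^ 2 with hS'
  have hSS : ∀ a b, IsEdge (oneRing T i) a b → S' a b = Real.exp (u a) * Real.exp (u b) * S a b := by
    intro a b hab
    simp only [hS, hS']
    rw [hu a b hab, mul_pow, ← Real.exp_nat_mul, ← Real.exp_add]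
    congr 2
    push_cast
    ring
  have e1 : ∀ k, IsEdge (oneRing T i) i (j k) := fun k => (h.isTriangle k).isEdge
  have e2 : ∀ k, IsEdge (oneRing T i) (j k) (j (k + 1)) := fun k => (h.isTriangle k).rotate.isEdge
  have Spos : ∀ a b, IsEdge (oneRing T i) a b → 0 < S a b := by
    intro a b hab
    have hne : Real.sinh (inducedLength φ a b / 2) ≠ 0 := by
      rw [Ne, Real.sinh_eq_zero]
      intro e
      exact hφ.ne hab (eq_of_hypDist_eq_zero (by simpa [inducedLength] using e)).symm
    simp only [hS]
    positivity
  set w : ZMod n → ℂ := fun k => farPoint (φ (vertexPoint i)) (φ (vertexPoint (j k))) with hw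
  set w' : ZMod n → ℂ := fun k => farPoint (φ' (vertexPoint i)) (φ' (vertexPoint (j k))) with hw'
  have fan : IsConvexFan (fun k => ‖w k - w (k + 1)‖) (fun k => ‖w k‖ ^ 2) := h.isConvexFan hφ hD
  have fan' : IsConvexFan (fun k => ‖w' k - w' (k + 1)‖) (fun k => ‖w' k‖ ^ 2) := h.isConvexFan hφ' hD'
  have hs : ∀ k, ‖w k‖ ^ 2 = 1 + 1 / S i (j k) := fun k => by
    rw [Complex.sq_norm]
    exact normSq_farPoint (hφ.ne (e1 k))
  have hs' : ∀ k, ‖w' k‖ ^ 2 = 1 + 1 / S' i (j k) := fun k => by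
    rw [Complex.sq_norm]
    exact normSq_farPoint (hφ'.ne (e1 k))
  have hl : ∀ k, ‖w k - w (k + 1)‖ ^ 2 = S (j k) (j (k + 1)) / (S i (j k) * S i (j (k + 1))) :=
    fun k => by
      rw [Complex.sq_norm]
      exact normSq_farPoint_sub (hφ.ne (e1 k)) (hφ.ne (e1 (k + 1)))
  have hl' : ∀ k, ‖w' k - w' (k + 1)‖ ^ 2 = S' (j k) (j (k + 1)) / (S' i (j k) * S' i (j (k + 1))) :=
    fun k => by
      rw [Complex.sq_norm]
      exact normSq_farPoint_sub (hφ'.ne (e1 k)) (hφ'.ne (e1 (k + 1)))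
  set c := Real.exp (u i) with hc
  have c0 : 0 < c := Real.exp_pos _
  have c1 : c ≤ 1 := Real.exp_le_one_iff.2 h0
  have lpos : ∀ k, 0 < ‖w k - w (k + 1)‖ := fun k => by
    have q1 := Spos _ _ (e1 k)
    have q2 := Spos _ _ (e1 (k + 1))
    have q3 := Spos _ _ (e2 k)
    have : 0 < ‖w k - w (k + 1)‖ ^ 2 := by rw [hl]; positivity
    exact (norm_nonneg _).lt_of_ne' ((pow_ne_zero_iff two_ne_zero).1 this.ne')
  -- The factors at `j k` and `j (k + 1)` cancel, leaving `exp (-u i)` for every side.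
  have hlen : (fun k => c * ‖w' k - w' (k + 1)‖) = fun k => ‖w k - w (k + 1)‖ := by
    funext k
    rw [← sq_eq_sq₀ (by positivity) (lpos k).le, mul_pow, hl, hl', hSS _ _ (e1 k),
      hSS _ _ (e1 (k + 1)), hSS _ _ (e2 k)]
    have q1 := Spos _ _ (e1 k)
    have q2 := Spos _ _ (e1 (k + 1))
    have := Real.exp_pos (u (j k))
    have := Real.exp_pos (u (j (k + 1)))
    rw [← hc]
    field_simp
  have fan'' := fan'.scale c0
  rw [hlen] at fan''
  have hspoke : ∀ k, c ^ 2 * ‖w' k‖ ^ 2 = c ^ 2 + c / Real.exp (u (j k)) * (1 / S i (j k)) := fun k => by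
    rw [hs', hSS _ _ (e1 k), ← hc]
    have q1 := Spos _ _ (e1 k)
    have := Real.exp_pos (u (j k))
    field_simp
  have r1 : ∀ k, c / Real.exp (u (j k)) ≤ 1 := fun k => by
    rw [div_le_one (Real.exp_pos _)]
    exact Real.exp_le_exp.2 (hle k)
  have c2 : c ^ 2 ≤ 1 := pow_le_one₀ c0.le c1
  have hinv : ∀ k, 0 < 1 / S i (j k) := fun k => one_div_pos.2 (Spos _ _ (e1 k))
  -- Both summands of the scaled squared spoke are at most those of `1 + 1 / S`: the first by `u i ≤
  -- 0`, the second by `u i ≤ u (j k)`.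
  have main := fan.eq_of_le lpos fan'' fun k => by
    rw [hspoke, hs]
    have := mul_le_mul_of_nonneg_right (r1 k) (hinv k).le
    linarith
  have heq : ∀ k, c ^ 2 = 1 ∧ c / Real.exp (u (j k)) = 1 := by
    intro k
    have e := congrFun main k
    rw [hspoke, hs] at e
    have p := mul_le_mul_of_nonneg_right (r1 k) (hinv k).le
    have hc2 : c ^ 2 = 1 := by linarith
    refine ⟨hc2, mul_right_cancel₀ (hinv k).ne' ?_⟩
    linarith
  have hci : c = 1 := (pow_eq_one_iff_of_nonneg c0.le two_ne_zero).1 (heq 0).1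
  refine ⟨Real.exp_eq_one_iff _ |>.1 hci, fun k => ?_⟩
  have := (heq k).2
  rw [hci, div_eq_one_iff_eq (Real.exp_pos _).ne', eq_comm, Real.exp_eq_one_iff] at this
  exact this

end OneRing

theorem mainTheorem4 {V : Type*} [DecidableEq V] (T : PreAbstractSimplicialComplex V)
    (hT : IsTriangulatedSurface T) (i : V) (hi : IsInteriorVertex T i)
    (φ φ' : (V → ℝ) → Complex.UnitDisc)
    (hφ : IsHypGeodesicEmbedding (oneRing T i) φ)
    (hφ' : IsHypGeodesicEmbedding (oneRing T i) φ')
    (hD : IsHypDelaunay (oneRing T i) φ) (hD' : IsHypDelaunay (oneRing T i) φ')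
    (u : V → ℝ)
    (hu : IsHypConformal (oneRing T i) (inducedLength φ) (inducedLength φ') u) :
    ∃ m m₀ : ℝ,
      IsLeast (insert 0 (u '' vertexSet (oneRing T i))) m ∧
      IsLeast (insert 0 (u '' boundaryVertexSet (oneRing T i))) m₀ ∧
      m₀ ≤ m ∧
      (u i = m → ∀ j ∈ vertexSet (oneRing T i), u j = 0) := by
  obtain ⟨n, hn, j, hj, hl⟩ := hi
  have h : IsCycleLink T i j := ⟨hn, hj, hl⟩
  have : NeZero n := ⟨by omega⟩
  rw [h.vertexSet_eq, h.boundaryVertexSet_eq]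
  obtain ⟨m, hm⟩ := (((Set.finite_range j).insert i).image u |>.insert 0).exists_minimal
    (Set.insert_nonempty _ _)
  obtain ⟨m₀, hm₀⟩ := ((Set.finite_range j).image u |>.insert 0).exists_minimal
    (Set.insert_nonempty _ _)
  rw [minimal_iff_isLeast] at hm hm₀
  -- The extra element `0` in the minimum supplies `u i ≤ 0`.
  have key : u i = m → u i = 0 ∧ ∀ k, u (j k) = 0 := fun e =>
    h.conformalFactor_eq_zero hφ hφ' hD hD' hu (e ▸ hm.2 (Or.inl rfl)) fun k =>
      e ▸ hm.2 (Or.inr ⟨j k, Or.inr ⟨k, rfl⟩, rfl⟩)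
  refine ⟨m, m₀, hm, hm₀, ?_, fun e v hv => ?_⟩
  · rcases hm.1 with e | ⟨v, rfl | hv, e⟩
    · exact e ▸ hm₀.2 (Or.inl rfl)
    · rw [← e, (key e).1]
      exact hm₀.2 (Or.inl rfl)
    · exact hm₀.2 (Or.inr ⟨v, hv, e⟩)
  · rcases hv with rfl | ⟨k, rfl⟩
    · exact (key e).1
    · exact (key e).2 k
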